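/- **Setting.** Let $\mathcal U$ be a finite set, let $\mathcal Y$ and $\Theta$ be measurable spaces, let $P$ be a transition kernel on $\mathcal U$ and $Q$ a Markov kernel from $\mathcal U$ to $\mathcal Y$. Let $n\ge 1$ and let $\mathcal S=((U_1,Y_1),\dots,(U_n,Y_n))$ be a random sample such that $(U_t)_{t=1}^n$ is a stationary ergodic Markov chain with transition kernel $P$ and stationary distribution $\pi$ (so $P$ is irreducible; aperiodicity also follows from the condition $\gamma_{ps}>0$ below), and such that each label depends only on its object: $(U_1,Y_1)\sim\pi(du)\,Q(u,dy)$ and, given $(U_1,Y_1),\dots,(U_t,Y_t)$, the pair $(U_{t+1},Y_{t+1})$ has law $P(U_t,du')\,Q(u',dy')$. Let $\pi_*=\min_{u\in\mathcal U}\pi(u)$ and $b(\pi_*)=\left(\ln\frac1{\pi_*}+2\ln 2+1\right)^{-1}$. Let $P^*(u,v)=\pi(v)P(v,u)/\pi(u)$ be the time reversal of $P$. For a transition matrix $A$ that is reversible with respect to $\pi$, let the spectral gap be $\gamma(A)=1-\sup\{x\in\mathrm{sp}(A):x\ne1\}$ if the eigenvalue $1$ of $A$ is simple, and $\gamma(A)=0$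 otherwise (for a one-point state space, $\gamma(A)=1$). The pseudo-spectral gap of the chain is $$\gamma_{ps}=\max_{k\ge1}\frac{\gamma\big((P^*)^kP^k\big)}{k}.$$ Let $\{f_\theta:\mathcal U\to\mathcal Y\mid\theta\in\Theta\}$ be predictors and $\ell:\mathcal Y^2\to[0,c]$ a loss such that $(\theta,u,y)\mapsto\ell(f_\theta(u),y)$ is measurable. Put $$r(\theta)=\frac1n\sum_{t=1}^n\ell(f_\theta(U_t),Y_t),\qquad R(\theta)=\mathbb E_{\mathcal S}[r(\theta)].$$ **Theorem.** Assume $\gamma_{ps}>0$. Then for every $\lambda>0$, every $\delta\in(0,1)$ and every prior probability distribution $\mu$ on $\Theta$, with probability at least $1-\delta$ over the sample, simultaneously for all probability distributions $\rho$ on $\Theta$, $$\mathbb E_{\theta\sim\rho}[R(\theta)]\le\mathbb E_{\theta\sim\rho}[r(\theta)]+\frac{\lambda c^2}{8n}\left(\frac{1-\left(\frac12\right)^{(n+1)b(\pi_*)\gamma_{ps}}}{1-\left(\frac12\right)^{b(\pi_*)\gamma_{ps}}}\right)^2+\frac{KL(\rho\|\mu)+\log\frac1\delta}{\lambda}.$$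 -/

import Mathlib

open MeasureTheory ProbabilityTheory

/-! ### Spectral quantities of a finite-state Markov chain -/

section Spectral

variable {S : Type*} [Fintype S] [DecidableEq S]

/-- The transition matrix `P(u, v) = P(u, {v})` of a transition kernel on a finite space. -/
noncomputable def transitionMatrix [MeasurableSpace S] (P : Kernel S S) : Matrix S S ℝ :=
  Matrix.of fun u v => (P u).real {v}

/-- The time reversal `A*(u, v) = π(v) A(v, u) / π(u)` of a transition matrix `A` with
stationary distribution `π`. -/
noncomputable def timeReversal (p : S → ℝ) (A : Matrix S S ℝ) : Matrix S S ℝ :=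
  Matrix.of fun u v => p v * A v u / p u

/-- The spectral gap of a reversible transition matrix (all of whose eigenvalues are real):
`1 - sup {x ∈ sp(A) : x ≠ 1}` if the eigenvalue `1` is simple, and `0` otherwise.
For a one-point state space the set of eigenvalues other than `1` is empty and the gap is `1`. -/
noncomputable def spectralGap (A : Matrix S S ℝ) : ℝ :=
  open scoped Classical in
  if Module.finrank ℝ (Module.End.eigenspace (Matrix.toLin' A) 1) = 1 then
    1 - sSup {x : ℝ | x ∈ spectrum ℝ A ∧ x ≠ 1}
  else 0

/-- The pseudo-spectral gap `sup_{k ≥ 1} γ((A*)^k A^k) / k`. -/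
noncomputable def pseudoSpectralGap (p : S → ℝ) (A : Matrix S S ℝ) : ℝ :=
  sSup {x : ℝ | ∃ k : ℕ, 1 ≤ k ∧ x = spectralGap (timeReversal p A ^ k * A ^ k) / k}

end Spectral

/-- `b(x) = (ln(1/x) + 2 ln 2 + 1)⁻¹`. -/
noncomputable def mixingConstant (x : ℝ) : ℝ :=
  (Real.log (1 / x) + 2 * Real.log 2 + 1)⁻¹

/-! ### The observations -/

section Observations

variable {𝒰 𝒴 Ω : Type*} [MeasurableSpace 𝒰] [MeasurableSpace 𝒴] [MeasurableSpace Ω]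

/-- The kernel `P(u, du') Q(u', dy')` on object-label pairs, started from the pair `(u, y)`. -/
noncomputable def pairKernel (P : Kernel 𝒰 𝒰) (Q : Kernel 𝒰 𝒴) : Kernel (𝒰 × 𝒴) (𝒰 × 𝒴) :=
  (P.compProd (Kernel.prodMkLeft 𝒰 Q)).comap Prod.fst measurable_fst

/-- `(U 0, Y 0), …, (U (n-1), Y (n-1))` is a stationary sample: the objects form a Markov chain
with transition kernel `P` started from its invariant distribution `p`, and each label is drawn
from `Q (U t)`. That is, the first pair has law `p(du) Q(u, dy)`, and given all the pairs up to
time `t` the next pair has law `P(U t, du') Q(u', dy')`. -/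
structure IsStationarySample (P : Kernel 𝒰 𝒰) (Q : Kernel 𝒰 𝒴) (p : Measure 𝒰) (n : ℕ)
    (U : ℕ → Ω → 𝒰) (Y : ℕ → Ω → 𝒴) (Pr : Measure Ω) : Prop where
  invariant : P.Invariant p
  initial : 0 < n → HasLaw (fun ω => (U 0 ω, Y 0 ω)) (p.compProd Q) Pr
  step : ∀ t : ℕ, t + 1 < n →
    HasCondDistrib (fun ω => (U (t + 1) ω, Y (t + 1) ω))
      (fun ω (s : Fin (t + 1)) => (U s ω, Y s ω))
      ((pairKernel P Q).comap (fun x : Fin (t + 1) → 𝒰 × 𝒴 => x (Fin.last t))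
        (measurable_pi_apply _)) Pr

variable {Θ : Type*}

/-- The empirical risk `r(θ)`, as a random variable. -/
noncomputable def empiricalRisk (f : Θ → 𝒰 → 𝒴) (ℓ : 𝒴 → 𝒴 → ℝ) (n : ℕ)
    (U : ℕ → Ω → 𝒰) (Y : ℕ → Ω → 𝒴) (θ : Θ) (ω : Ω) : ℝ :=
  (1 / (n : ℝ)) * ∑ t ∈ Finset.range n, ℓ (f θ (U t ω)) (Y t ω)

/-- The risk `R(θ)`, the expected empirical risk. -/
noncomputable def risk (f : Θ → 𝒰 → 𝒴) (ℓ : 𝒴 → 𝒴 → ℝ) (n : ℕ)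
    (U : ℕ → Ω → 𝒰) (Y : ℕ → Ω → 𝒴) (Pr : Measure Ω) (θ : Θ) : ℝ :=
  ∫ ω, empiricalRisk f ℓ n U Y θ ω ∂Pr

end Observations

/-! ### Reversibilization and the spectral gap in L²(p) -/

section FiniteChain

open Matrix

variable {S : Type*} [Fintype S]

/-! The proof combines a martingale exponential moment bound with the PAC-Bayes change of measure.
For a fixed predictor let `g` be the loss of a pair, `h` its average over the label, and `futureSum
A h m` the expected sum of the next `m` losses. Given the past, a new pair `z` followed by `m`
further ones enters through `g z + futureSum A h m z.1`. Hoeffding's lemma, applied to the pairs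
from last to first, bounds the exponential moment of the centred sum by `exp (l² / 8 * ∑ d m ^ 2)`,
where `d m` bounds the oscillation of that function (`integral_exp_sub_sum_le`).

The oscillation is at most `c * s m`, where `s m` is the sum of `τ k` over `k ≤ m` and `c * τ k`
bounds the oscillation of `A ^ k *ᵥ h`. The pseudo-spectral gap γ makes mean-zero functions decay
exponentially in L²(p), and the smallest mass of `p` turns this into pointwise decay
(`abs_pow_mulVec_sub_le`). Hence `s m ≤ m + 1` and `γ * s m ≤ B`, with `B` the inverse of the mixing
constant. These two bounds alone put the sum of squares below `n` times the squared geometric ratio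
of the theorem (`sum_sq_le_mul_sq_geom`).

Finally the Donsker–Varadhan inequality and Markov's inequality turn the moment bound, uniform in θ,
into one event that serves every posterior (`exists_event_forall_integral_le_klDiv`). -/

theorem sum_mul_timeReversal_mul_mulVec {p : S → ℝ} (hp : ∀ u, 0 < p u) (C : Matrix S S ℝ)
    (x y : S → ℝ) :
    ∑ u, p u * (x u * ((timeReversal p C * C) *ᵥ y) u)
      = ∑ u, p u * ((C *ᵥ x) u * (C *ᵥ y) u) := by
  -- `timeReversal p C` is the adjoint of `C` for the inner product weighted by `p`.
  rw [← mulVec_mulVec]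
  set z := C *ᵥ y
  simp only [mulVec, dotProduct, timeReversal, of_apply, Finset.mul_sum, Finset.sum_mul]
  rw [Finset.sum_comm]
  refine Finset.sum_congr rfl fun v _ => Finset.sum_congr rfl fun u _ => ?_
  have := (hp u).ne'
  field_simp

variable [DecidableEq S]

theorem timeReversal_eq (p : S → ℝ) (A : Matrix S S ℝ) :
    timeReversal p A = diagonal (fun u => (p u)⁻¹) * Aᵀ * diagonal p := by
  ext u v
  simp [timeReversal, Matrix.mul_diagonal, Matrix.diagonal_mul, div_eq_mul_inv]
  ring

/-- Adjoints reverse products, which is harmless for powers of one matrix. Each term of the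
pseudo-spectral gap thus concerns the reversibilization of the single matrix `A ^ k`. -/
theorem timeReversal_pow {p : S → ℝ} (hp : ∀ u, 0 < p u) (A : Matrix S S ℝ) (k : ℕ) :
    timeReversal p A ^ k = timeReversal p (A ^ k) := by
  have hD : diagonal p * diagonal (fun u => (p u)⁻¹) = 1 := by
    rw [diagonal_mul_diagonal, ← diagonal_one]
    congr 1; ext u; exact mul_inv_cancel₀ (hp u).ne'
  induction k with
  | zero =>
    ext u v
    by_cases h : u = v
    · subst h; simp [timeReversal, (hp u).ne']
    · simp [timeReversal, h, Ne.symm h]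
  | succ k ih =>
    rw [pow_succ, ih, pow_succ', timeReversal_eq, timeReversal_eq, timeReversal_eq, transpose_mul]
    calc _ = diagonal (fun u => (p u)⁻¹) * (A ^ k)ᵀ
          * (diagonal p * diagonal (fun u => (p u)⁻¹)) * Aᵀ * diagonal p := by
            simp only [Matrix.mul_assoc]
      _ = _ := by rw [hD]; simp only [Matrix.mul_assoc, Matrix.one_mul]

theorem mem_spectrum_iff_exists_mulVec (A : Matrix S S ℝ) (x : ℝ) :
    x ∈ spectrum ℝ A ↔ ∃ y : S → ℝ, y ≠ 0 ∧ A *ᵥ y = x • y := by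
  rw [← Matrix.spectrum_toLin', ← Module.End.hasEigenvalue_iff_mem_spectrum]
  constructor
  · intro h
    obtain ⟨y, hy⟩ := h.exists_hasEigenvector
    exact ⟨y, hy.2, by simpa using hy.apply_eq_smul⟩
  · rintro ⟨y, hy, h⟩
    exact Module.End.hasEigenvalue_of_hasEigenvector
      (Module.End.hasEigenvector_iff.2 ⟨Module.End.mem_eigenspace_iff.2 (by simpa using h), hy⟩)

theorem spectrum_timeReversal_mul_nonneg {p : S → ℝ} (hp : ∀ u, 0 < p u) (C : Matrix S S ℝ)
    {x : ℝ} (hx : x ∈ spectrum ℝ (timeReversal p C * C)) : 0 ≤ x := by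
  obtain ⟨y, hy, h⟩ := (mem_spectrum_iff_exists_mulVec _ _).1 hx
  have h1 := sum_mul_timeReversal_mul_mulVec hp C y y
  rw [h] at h1
  have h2 : 0 < ∑ u, p u * (y u * y u) := by
    obtain ⟨u, hu⟩ := Function.ne_iff.1 hy
    exact Finset.sum_pos' (fun v _ => mul_nonneg (hp v).le (mul_self_nonneg _))
      ⟨u, Finset.mem_univ _, mul_pos (hp u) (mul_self_pos.2 hu)⟩
  have h3 : 0 ≤ ∑ u, p u * ((C *ᵥ y) u * (C *ᵥ y) u) :=
    Finset.sum_nonneg fun v _ => mul_nonneg (hp v).le (mul_self_nonneg _)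
  have h4 : ∑ u, p u * (y u * (x • y) u) = x * ∑ u, p u * (y u * y u) := by
    rw [Finset.mul_sum]; exact Finset.sum_congr rfl fun u _ => by simp; ring
  rw [← h1, h4] at h3
  exact nonneg_of_mul_nonneg_left h3 h2

theorem spectralGap_timeReversal_mul_le_one {p : S → ℝ} (hp : ∀ u, 0 < p u)
    (C : Matrix S S ℝ) : spectralGap (timeReversal p C * C) ≤ 1 := by
  unfold spectralGap
  split_ifs
  · have := Real.sSup_nonneg (s := {x : ℝ | x ∈ spectrum ℝ (timeReversal p C * C) ∧ x ≠ 1})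
      fun x hx => spectrum_timeReversal_mul_nonneg hp C hx.1
    linarith
  · exact zero_le_one

/-- A matrix preserving constants and the weights `p` contracts mean-zero functions in
`L²(p)` at the rate given by the spectral gap of its multiplicative reversibilization. -/
theorem sum_mul_mulVec_sq_le_of_spectralGap_pos {p : S → ℝ} (hp : ∀ u, 0 < p u)
    {C : Matrix S S ℝ} (hC : C *ᵥ 1 = 1) (hpC : p ᵥ* C = p)
    (hgap : 0 < spectralGap (timeReversal p C * C)) {h : S → ℝ} (hh : ∑ u, p u * h u = 0) :
    ∑ u, p u * (C *ᵥ h) u ^ 2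
      ≤ (1 - spectralGap (timeReversal p C * C)) * ∑ u, p u * h u ^ 2 := by
  set R := timeReversal p C * C with hR
  set s : S → ℝ := fun u => √(p u) with hs
  have hs0 : ∀ u, 0 < s u := fun u => Real.sqrt_pos.2 (hp u)
  have hss : ∀ u, s u * s u = p u := fun u => Real.mul_self_sqrt (hp u).le
  -- Conjugation by √p turns `R`, self-adjoint in L²(p), into the symmetric matrix `Bᵀ * B`, which
  -- has an orthonormal eigenbasis.
  set B := diagonal s * C * diagonal (fun u => (s u)⁻¹) with hB
  have hM : (Bᵀ * B).IsHermitian := by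
    simp [Matrix.IsHermitian, conjTranspose_eq_transpose_of_trivial]
  set e : S → S → ℝ := fun i => ⇑(hM.eigenvectorBasis i) with he
  set ev := hM.eigenvalues with hev
  have hsum : ∀ x y : S → ℝ, ∑ i, (x ⬝ᵥ e i) * (e i ⬝ᵥ y) = x ⬝ᵥ y := by
    intro x y
    have := hM.eigenvectorBasis.sum_inner_mul_inner (WithLp.toLp 2 x) (WithLp.toLp 2 y)
    simp only [EuclideanSpace.inner_eq_star_dotProduct] at this
    simp only [star_trivial] at this
    rw [dotProduct_comm x y, ← this]
    refine Finset.sum_congr rfl fun i _ => ?_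
    rw [dotProduct_comm x, dotProduct_comm (e i) y]
  have heig : ∀ i, (Bᵀ * B) *ᵥ e i = ev i • e i := hM.mulVec_eigenvectorBasis
  have hMR : ∀ y : S → ℝ, R *ᵥ (fun u => (s u)⁻¹ * y u)
      = fun u => (s u)⁻¹ * ((Bᵀ * B) *ᵥ y) u := by
    intro y
    have : R * diagonal (fun u => (s u)⁻¹) = diagonal (fun u => (s u)⁻¹) * (Bᵀ * B) := by
      rw [hR, timeReversal_eq, hB]
      simp only [transpose_mul, diagonal_transpose]
      have h1 : (diagonal (fun u => (p u)⁻¹) : Matrix S S ℝ)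
          = diagonal (fun u => (s u)⁻¹) * diagonal (fun u => (s u)⁻¹) := by
        rw [diagonal_mul_diagonal]; congr 1; ext u; rw [← hss u, mul_inv]
      have h2 : (diagonal p : Matrix S S ℝ) = diagonal s * diagonal s := by
        rw [diagonal_mul_diagonal]; congr 1; ext u; exact (hss u).symm
      rw [h1, h2]
      simp only [Matrix.mul_assoc]
    have hd : ∀ z : S → ℝ, (fun u => (s u)⁻¹ * z u) = diagonal (fun u => (s u)⁻¹) *ᵥ z :=
      fun z => by ext u; rw [mulVec_diagonal]
    rw [hd, hd, mulVec_mulVec, mulVec_mulVec, this]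
  set w : S → ℝ := fun u => s u * h u with hw
  have hwh : h = fun u => (s u)⁻¹ * w u := by
    ext u; rw [hw, inv_mul_cancel_left₀ (hs0 u).ne']
  have hnorm : ∑ u, p u * h u ^ 2 = ∑ i, (w ⬝ᵥ e i) ^ 2 := by
    calc ∑ u, p u * h u ^ 2 = w ⬝ᵥ w :=
          Finset.sum_congr rfl fun u _ => by rw [← hss u, hw]; ring
      _ = _ := by
        rw [← hsum]
        exact Finset.sum_congr rfl fun i _ => by rw [dotProduct_comm (e i), sq]
  have hMw : ∀ i, e i ⬝ᵥ ((Bᵀ * B) *ᵥ w) = ev i * (w ⬝ᵥ e i) := by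
    intro i
    have ht : (Bᵀ * B)ᵀ = Bᵀ * B := by rw [transpose_mul, transpose_transpose]
    rw [dotProduct_mulVec, ← mulVec_transpose, ht, heig, smul_dotProduct, dotProduct_comm,
      smul_eq_mul]
  have hform : ∑ u, p u * (C *ᵥ h) u ^ 2 = ∑ i, ev i * (w ⬝ᵥ e i) ^ 2 := by
    calc ∑ u, p u * (C *ᵥ h) u ^ 2 = ∑ u, p u * ((C *ᵥ h) u * (C *ᵥ h) u) := by simp only [sq]
      _ = ∑ u, p u * (h u * (R *ᵥ h) u) := (sum_mul_timeReversal_mul_mulVec hp C h h).symm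
      _ = w ⬝ᵥ ((Bᵀ * B) *ᵥ w) := by
        refine Finset.sum_congr rfl fun u _ => ?_
        have h1 : (R *ᵥ h) u = (s u)⁻¹ * ((Bᵀ * B) *ᵥ w) u := by rw [hwh, hMR]
        have h2 := (hs0 u).ne'
        rw [h1, ← hss u]
        field_simp
        simp only [hw]
        ring
      _ = _ := by
        rw [← hsum]
        exact Finset.sum_congr rfl fun i _ => by rw [hMw]; ring
  set x : S → S → ℝ := fun i u => (s u)⁻¹ * e i u with hx
  have hxR : ∀ i, R *ᵥ x i = ev i • x i := by
    intro i
    rw [hx]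
    simp only
    rw [hMR, heig]
    ext u; simp; ring
  have hx0 : ∀ i, x i ≠ 0 := by
    intro i h0
    have : hM.eigenvectorBasis i = 0 := by
      ext u
      have := congrFun h0 u
      simpa [hx, (hs0 u).ne'] using this
    exact hM.eigenvectorBasis.orthonormal.ne_zero i this
  have hsimple : Module.finrank ℝ (Module.End.eigenspace (Matrix.toLin' R) 1) = 1 := by
    by_contra hne
    simp [spectralGap, hne] at hgap
  have hgapR : 1 - spectralGap R = sSup {x : ℝ | x ∈ spectrum ℝ R ∧ x ≠ 1} := by
    rw [spectralGap, if_pos hsimple]; ring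
  have hR1 : R *ᵥ 1 = 1 := by
    rw [hR, ← mulVec_mulVec, hC]
    ext u
    have := congrFun hpC u
    simp only [vecMul, dotProduct] at this
    simp only [mulVec, dotProduct, timeReversal, of_apply, Pi.one_apply, mul_one]
    rw [← Finset.sum_div, this, div_self (hp u).ne']
  rw [hform, hnorm, Finset.mul_sum]
  refine Finset.sum_le_sum fun i _ => ?_
  by_cases hi : ev i = 1
  -- The constants already span the simple eigenspace of 1, so `e i` is a multiple of √p and the
  -- zero mean of `h` kills this coefficient.
  · have hzero : w ⬝ᵥ e i = 0 := by
      have h1 : (1 : S → ℝ) ∈ Module.End.eigenspace (Matrix.toLin' R) 1 :=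
        Module.End.mem_eigenspace_iff.2 (by simpa using hR1)
      have h2 : x i ∈ Module.End.eigenspace (Matrix.toLin' R) 1 :=
        Module.End.mem_eigenspace_iff.2 (by simpa [hi] using hxR i)
      have hne : (⟨1, h1⟩ : Module.End.eigenspace (Matrix.toLin' R) 1) ≠ 0 := by
        intro h0
        have h3 : (1 : S → ℝ) = 0 := congrArg Subtype.val h0
        have : Nonempty S := ⟨i⟩
        exact one_ne_zero h3
      obtain ⟨a, ha⟩ := (finrank_eq_one_iff_of_nonzero' _ hne).1 hsimple ⟨x i, h2⟩
      have ha' : ∀ u, e i u = a * s u := by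
        intro u
        have h4 : a • (1 : S → ℝ) = x i := congrArg Subtype.val ha
        have h5 := congrFun h4 u
        simp only [Pi.smul_apply, Pi.one_apply, smul_eq_mul, mul_one, hx] at h5
        rw [h5, mul_right_comm, inv_mul_cancel₀ (hs0 u).ne', one_mul]
      calc w ⬝ᵥ e i = a * ∑ u, p u * h u := by
            rw [Finset.mul_sum]
            refine Finset.sum_congr rfl fun u _ => ?_
            rw [ha', ← hss u, hw]; ring
        _ = 0 := by rw [hh, mul_zero]
    simp [hzero]
  · refine mul_le_mul_of_nonneg_right ?_ (sq_nonneg _)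
    rw [hgapR]
    exact le_csSup ((Matrix.finite_spectrum R).subset fun y hy => hy.1).bddAbove
      ⟨(mem_spectrum_iff_exists_mulVec _ _).2 ⟨x i, hx0 i, hxR i⟩, hi⟩

end FiniteChain

/-! ### From the pseudo-spectral gap to pointwise oscillation decay -/

section Contraction

open Matrix

variable {S : Type*} [Fintype S]

theorem sum_mul_mulVec_of_vecMul_eq {p : S → ℝ} {C : Matrix S S ℝ} (hpC : p ᵥ* C = p)
    (h : S → ℝ) : ∑ u, p u * (C *ᵥ h) u = ∑ u, p u * h u := by
  change p ⬝ᵥ (C *ᵥ h) = p ⬝ᵥ h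
  rw [dotProduct_mulVec, hpC]

theorem mulVec_sq_le {C : Matrix S S ℝ} (hC0 : ∀ u v, 0 ≤ C u v) (hC : C *ᵥ 1 = 1)
    (h : S → ℝ) (u : S) : (C *ᵥ h) u ^ 2 ≤ (C *ᵥ fun v => h v ^ 2) u := by
  have h1 : ∑ v, C u v = 1 := by simpa [mulVec, dotProduct] using congrFun hC u
  have := (even_two.convexOn_pow (𝕜 := ℝ)).map_sum_le (t := Finset.univ) (w := C u) (p := h)
    (fun v _ => hC0 u v) h1 (fun _ _ => Set.mem_univ _)
  simpa [mulVec, dotProduct] using this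

theorem sum_mul_mulVec_sq_le {p : S → ℝ} (hp : ∀ u, 0 ≤ p u) {C : Matrix S S ℝ}
    (hC0 : ∀ u v, 0 ≤ C u v) (hC : C *ᵥ 1 = 1) (hpC : p ᵥ* C = p) (h : S → ℝ) :
    ∑ u, p u * (C *ᵥ h) u ^ 2 ≤ ∑ u, p u * h u ^ 2 := by
  rw [← sum_mul_mulVec_of_vecMul_eq hpC (fun u => h u ^ 2)]
  exact Finset.sum_le_sum fun u _ => mul_le_mul_of_nonneg_left (mulVec_sq_le hC0 hC h u) (hp u)

theorem mulVec_mem_Icc {C : Matrix S S ℝ} (hC0 : ∀ u v, 0 ≤ C u v) (hC : C *ᵥ 1 = 1)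
    {h : S → ℝ} {a b : ℝ} (hh : ∀ u, h u ∈ Set.Icc a b) (u : S) :
    (C *ᵥ h) u ∈ Set.Icc a b := by
  have h1 : ∑ v, C u v = 1 := by simpa [mulVec, dotProduct] using congrFun hC u
  have h2 : ∀ x : ℝ, x = ∑ v, C u v * x := fun x => by rw [← Finset.sum_mul, h1, one_mul]
  constructor
  · rw [h2 a]
    exact Finset.sum_le_sum fun v _ => mul_le_mul_of_nonneg_left (hh v).1 (hC0 u v)
  · rw [h2 b]
    exact Finset.sum_le_sum fun v _ => mul_le_mul_of_nonneg_left (hh v).2 (hC0 u v)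

variable [DecidableEq S]

theorem pow_mulVec_one {A : Matrix S S ℝ} (hA : A *ᵥ 1 = 1) (k : ℕ) : A ^ k *ᵥ 1 = 1 := by
  induction k with
  | zero => simp
  | succ k ih => rw [pow_succ, ← mulVec_mulVec, hA, ih]

theorem vecMul_pow {p : S → ℝ} {A : Matrix S S ℝ} (hpA : p ᵥ* A = p) (k : ℕ) :
    p ᵥ* A ^ k = p := by
  induction k with
  | zero => simp
  | succ k ih => rw [pow_succ, ← vecMul_vecMul, ih, hpA]

theorem matrix_pow_nonneg {A : Matrix S S ℝ} (hA0 : ∀ u v, 0 ≤ A u v) (k : ℕ) (u v : S) :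
    0 ≤ (A ^ k) u v := by
  induction k generalizing u v with
  | zero => by_cases h : u = v <;> simp [h]
  | succ k ih =>
    rw [pow_succ, mul_apply]
    exact Finset.sum_nonneg fun w _ => mul_nonneg (ih u w) (hA0 w v)

/-- Split `t` steps into `t / k` blocks of length `k`, each contracting by `1 - g ≤ exp (-g)`; the
remaining steps do not expand. As `t + 1 ≤ k * (t / k) + k` and `γ * k ≤ g ≤ 1`, the incomplete
block costs at most the factor `exp 1`. -/
theorem sum_mul_pow_mulVec_sq_le {p : S → ℝ} (hp : ∀ u, 0 < p u) {A : Matrix S S ℝ}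
    (hA0 : ∀ u v, 0 ≤ A u v) (hA : A *ᵥ 1 = 1) (hpA : p ᵥ* A = p) {h : S → ℝ}
    (hh : ∑ u, p u * h u = 0) {k : ℕ} (hk : 1 ≤ k) {γ : ℝ} (hγ : 0 < γ)
    (hγk : γ ≤ spectralGap (timeReversal p A ^ k * A ^ k) / k) (t : ℕ) :
    ∑ u, p u * (A ^ t *ᵥ h) u ^ 2 ≤ Real.exp (1 - γ * (t + 1)) * ∑ u, p u * h u ^ 2 := by
  rw [timeReversal_pow hp] at hγk
  set g := spectralGap (timeReversal p (A ^ k) * A ^ k) with hg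
  have hk0 : (0 : ℝ) < k := by exact_mod_cast hk
  have hγg : γ * k ≤ g := by rwa [le_div_iff₀ hk0] at hγk
  have hg0 : 0 < g := lt_of_lt_of_le (by positivity) hγg
  have hg1 : g ≤ 1 := spectralGap_timeReversal_mul_le_one hp _
  have hiter : ∀ j : ℕ, ∀ h : S → ℝ, ∑ u, p u * h u = 0 →
      ∑ u, p u * ((A ^ k) ^ j *ᵥ h) u ^ 2 ≤ (1 - g) ^ j * ∑ u, p u * h u ^ 2 := by
    intro j
    induction j with
    | zero => intro h _; simp
    | succ j ih =>
      intro h hh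
      rw [pow_succ, ← mulVec_mulVec, pow_succ, mul_assoc]
      refine (ih _ ?_).trans (mul_le_mul_of_nonneg_left ?_ (pow_nonneg (by linarith) _))
      · rw [sum_mul_mulVec_of_vecMul_eq (vecMul_pow hpA k), hh]
      · exact sum_mul_mulVec_sq_le_of_spectralGap_pos hp (pow_mulVec_one hA k)
          (vecMul_pow hpA k) hg0 hh
  have hdecomp : A ^ t = (A ^ k) ^ (t / k) * A ^ (t % k) := by
    rw [← pow_mul, ← pow_add, Nat.div_add_mod]
  have hN : 0 ≤ ∑ u, p u * h u ^ 2 :=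
    Finset.sum_nonneg fun u _ => mul_nonneg (hp u).le (sq_nonneg _)
  rw [hdecomp, ← mulVec_mulVec]
  refine (hiter _ _ (by rw [sum_mul_mulVec_of_vecMul_eq (vecMul_pow hpA _), hh])).trans ?_
  refine (mul_le_mul_of_nonneg_left (sum_mul_mulVec_sq_le (fun u => (hp u).le)
    (matrix_pow_nonneg hA0 _) (pow_mulVec_one hA _) (vecMul_pow hpA _) h)
    (pow_nonneg (by linarith) _)).trans (mul_le_mul_of_nonneg_right ?_ hN)
  calc (1 - g) ^ (t / k) ≤ Real.exp (-g) ^ (t / k) :=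
        pow_le_pow_left₀ (by linarith) (Real.one_sub_le_exp_neg g) _
    _ = Real.exp (-(g * (t / k : ℕ))) := by rw [← Real.exp_nat_mul]; congr 1; ring
    _ ≤ _ := by
      refine Real.exp_le_exp.2 ?_
      have h1 : (t : ℝ) + 1 ≤ k * (t / k : ℕ) + k := by
        have := Nat.div_add_mod t k
        have := Nat.mod_lt t hk
        exact_mod_cast (by omega : t + 1 ≤ k * (t / k) + k)
      have h2 : γ * k * (t / k : ℕ) ≤ g * (t / k : ℕ) :=
        mul_le_mul_of_nonneg_right hγg (Nat.cast_nonneg _)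
      nlinarith [mul_le_mul_of_nonneg_left h1 hγ.le]

theorem sum_mul_pow_mulVec_sq_le_of_pseudoSpectralGap {p : S → ℝ} (hp : ∀ u, 0 < p u)
    {A : Matrix S S ℝ} (hA0 : ∀ u v, 0 ≤ A u v) (hA : A *ᵥ 1 = 1) (hpA : p ᵥ* A = p)
    (hγ : 0 < pseudoSpectralGap p A) {h : S → ℝ} (hh : ∑ u, p u * h u = 0) (t : ℕ) :
    ∑ u, p u * (A ^ t *ᵥ h) u ^ 2
      ≤ Real.exp (1 - pseudoSpectralGap p A * (t + 1)) * ∑ u, p u * h u ^ 2 := by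
  set γ := pseudoSpectralGap p A with hγdef
  -- The supremum need not be attained, so the bound is proved for every smaller rate and passed to
  -- the limit.
  have hlim : Filter.Tendsto
      (fun x : ℝ => Real.exp (1 - x * (t + 1)) * ∑ u, p u * h u ^ 2)
      (nhdsWithin γ (Set.Iio γ)) (nhds (Real.exp (1 - γ * (t + 1)) * ∑ u, p u * h u ^ 2)) :=
    (Continuous.tendsto (by fun_prop) γ).mono_left nhdsWithin_le_nhds
  refine ge_of_tendsto hlim ?_
  filter_upwards [Ioo_mem_nhdsLT hγ] with x hx
  obtain ⟨y, ⟨k, hk, rfl⟩, hxy⟩ := exists_lt_of_lt_csSup (s := {x : ℝ | ∃ k : ℕ, 1 ≤ k ∧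
    x = spectralGap (timeReversal p A ^ k * A ^ k) / k}) ⟨_, 1, le_rfl, rfl⟩ hx.2
  exact sum_mul_pow_mulVec_sq_le hp hA0 hA hpA hh hk hx.1 hxy.le t

/-- A function with values in `[0, c]` has variance at most `c² / 4`. Two distinct points each carry
mass at least `m`, and `(F u - F v)² ≤ 2 (F u² + F v²)`; together these give the factor `c² / (2
m)`, the source of `log (1 / m) - log 2`. -/
theorem abs_pow_mulVec_sub_le {p : S → ℝ} (hp : ∀ u, 0 < p u) (hp1 : ∑ u, p u = 1)
    {A : Matrix S S ℝ} (hA0 : ∀ u v, 0 ≤ A u v) (hA : A *ᵥ 1 = 1) (hpA : p ᵥ* A = p)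
    (hγ : 0 < pseudoSpectralGap p A) {m : ℝ} (hm : 0 < m) (hmp : ∀ u, m ≤ p u)
    {h : S → ℝ} {c : ℝ} (hc : 0 ≤ c) (hh : ∀ u, h u ∈ Set.Icc 0 c) (t : ℕ) (u v : S) :
    (A ^ t *ᵥ h) u - (A ^ t *ᵥ h) v
      ≤ c * min 1 (Real.exp ((Real.log (1 / m) + 1 - Real.log 2
          - pseudoSpectralGap p A * (t + 1)) / 2)) := by
  rw [mul_min_of_nonneg _ _ hc, mul_one]
  have hA0t := matrix_pow_nonneg hA0 t
  have hAt := pow_mulVec_one hA t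
  refine le_min ?_ ?_
  · have h1 := mulVec_mem_Icc hA0t hAt hh u
    have h2 := mulVec_mem_Icc hA0t hAt hh v
    linarith [h1.2, h2.1]
  by_cases huv : u = v
  · subst huv; rw [sub_self]; positivity
  set γ := pseudoSpectralGap p A
  set a := ∑ u, p u * h u with ha
  set h' : S → ℝ := fun u => h u - a with hh'
  have hmean : ∑ u, p u * h' u = 0 := by
    simp only [hh', mul_sub, Finset.sum_sub_distrib, ← Finset.sum_mul, hp1, one_mul]
    rw [← ha, sub_self]
  have hvar : ∑ u, p u * h' u ^ 2 ≤ c ^ 2 / 4 := by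
    have h1 : ∑ u, p u * (h u - c / 2) ^ 2 ≤ c ^ 2 / 4 := by
      calc _ ≤ ∑ u, p u * (c ^ 2 / 4) := by
            refine Finset.sum_le_sum fun u _ => mul_le_mul_of_nonneg_left ?_ (hp u).le
            nlinarith [mul_nonneg (hh u).1 (sub_nonneg.2 (hh u).2)]
        _ = _ := by rw [← Finset.sum_mul, hp1, one_mul]
    have h2 : ∑ u, p u * (h u - c / 2) ^ 2 = ∑ u, p u * h' u ^ 2 + (a - c / 2) ^ 2 := by
      have : ∀ u, p u * (h u - c / 2) ^ 2
          = p u * h' u ^ 2 + 2 * (a - c / 2) * (p u * h' u) + p u * (a - c / 2) ^ 2 := by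
        intro u; simp only [hh']; ring
      simp only [this, Finset.sum_add_distrib, ← Finset.mul_sum, ← Finset.sum_mul, hmean, hp1]
      ring
    nlinarith [sq_nonneg (a - c / 2)]
  set F := A ^ t *ᵥ h' with hF
  have hdiff : (A ^ t *ᵥ h) u - (A ^ t *ᵥ h) v = F u - F v := by
    have : h = h' + a • (1 : S → ℝ) := by ext u; simp [hh']
    rw [this, mulVec_add, mulVec_smul, hAt]
    simp [hF]
  have hFsum := sum_mul_pow_mulVec_sq_le_of_pseudoSpectralGap hp hA0 hA hpA hγ hmean t
  have hpair : m * (F u ^ 2 + F v ^ 2) ≤ ∑ w, p w * F w ^ 2 := by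
    calc m * (F u ^ 2 + F v ^ 2) ≤ p u * F u ^ 2 + p v * F v ^ 2 := by
          nlinarith [mul_le_mul_of_nonneg_right (hmp u) (sq_nonneg (F u)),
            mul_le_mul_of_nonneg_right (hmp v) (sq_nonneg (F v))]
      _ = ∑ w ∈ {u, v}, p w * F w ^ 2 := by rw [Finset.sum_pair huv]
      _ ≤ _ := Finset.sum_le_sum_of_subset_of_nonneg (Finset.subset_univ _)
          fun w _ _ => mul_nonneg (hp w).le (sq_nonneg _)
  have hexp : Real.exp (Real.log (1 / m) + 1 - Real.log 2 - γ * (t + 1))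
      = Real.exp (1 - γ * (t + 1)) / (2 * m) := by
    have : Real.log (1 / m) + 1 - Real.log 2 - γ * (t + 1)
        = Real.log (1 / m) - Real.log 2 + (1 - γ * (t + 1)) := by ring
    rw [this, Real.exp_add, Real.exp_sub, Real.exp_log (by positivity),
      Real.exp_log (by norm_num)]
    field_simp
  rw [hdiff]
  refine abs_le_of_sq_le_sq' ?_ (by positivity) |>.2
  rw [mul_pow, ← Real.exp_nat_mul]
  have : ((2 : ℕ) : ℝ) * ((Real.log (1 / m) + 1 - Real.log 2 - γ * (t + 1)) / 2)
      = Real.log (1 / m) + 1 - Real.log 2 - γ * (t + 1) := by push_cast; ring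
  rw [this, hexp, ← mul_div_assoc, le_div_iff₀ (by positivity)]
  have hE : 0 < Real.exp (1 - γ * (t + 1)) := Real.exp_pos _
  nlinarith [mul_le_mul_of_nonneg_left hvar hE.le, mul_nonneg hm.le (sq_nonneg (F u + F v))]

end Contraction

/-! ### Numerical comparison with the geometric ratio -/

section Numeric

theorem mul_sum_min_exp_le {x₀ γ : ℝ} (hx₀ : 0 ≤ x₀) (hγ : 0 < γ) (m : ℕ) :
    γ * ∑ k ∈ Finset.range m, min 1 (Real.exp ((x₀ - γ * (k + 1)) / 2)) ≤ x₀ + 2 := by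
  -- `H` is the primitive of `min 1 (exp ((x₀ - x) / 2))` vanishing at 0. The integrand is
  -- nonincreasing, so the right-endpoint Riemann sum telescopes below `H`.
  set H : ℝ → ℝ := fun x => if x ≤ x₀ then x else x₀ + 2 - 2 * Real.exp ((x₀ - x) / 2) with hH
  have hstep : ∀ x, γ * min 1 (Real.exp ((x₀ - x) / 2)) ≤ H x - H (x - γ) := by
    intro x
    simp only [hH]
    have hmin1 := mul_le_mul_of_nonneg_left (min_le_left 1 (Real.exp ((x₀ - x) / 2))) hγ.le
    have hmin2 := mul_le_mul_of_nonneg_left (min_le_right 1 (Real.exp ((x₀ - x) / 2))) hγ.le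
    split_ifs with h1 h2 h2
    · linarith
    · linarith
    · set e := Real.exp ((x₀ - x) / 2)
      have he1 : e ≤ 1 := Real.exp_le_one_iff.2 (by linarith)
      have he0 : 0 < e := Real.exp_pos _
      have h3 : e * (1 + (x - x₀) / 2) ≤ 1 := by
        calc e * (1 + (x - x₀) / 2) ≤ e * Real.exp ((x - x₀) / 2) :=
              mul_le_mul_of_nonneg_left (by linarith [Real.add_one_le_exp ((x - x₀) / 2)]) he0.le
          _ = 1 := by rw [← Real.exp_add, ← Real.exp_zero]; congr 1; ring
      nlinarith [mul_nonneg (by linarith : 0 ≤ γ - (x - x₀)) (by linarith : 0 ≤ 1 - e)]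
    · set e := Real.exp ((x₀ - x) / 2)
      have he0 : 0 < e := Real.exp_pos _
      have h3 : Real.exp ((x₀ - (x - γ)) / 2) = e * Real.exp (γ / 2) := by
        rw [← Real.exp_add]; congr 1; ring
      have h4 : e * (γ / 2 + 1) ≤ e * Real.exp (γ / 2) :=
        mul_le_mul_of_nonneg_left (Real.add_one_le_exp _) he0.le
      rw [h3]
      linarith
  have htel : γ * ∑ k ∈ Finset.range m, min 1 (Real.exp ((x₀ - γ * (k + 1)) / 2))
      ≤ H (γ * m) - H 0 := by
    induction m with
    | zero => simp
    | succ m ih =>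
      rw [Finset.sum_range_succ, mul_add]
      have h1 := hstep (γ * (m + 1))
      rw [show γ * ((m : ℝ) + 1) - γ = γ * m by ring] at h1
      push_cast
      linarith
  have h0 : H 0 = 0 := by simp [hH, hx₀]
  have hle : H (γ * m) ≤ x₀ + 2 := by
    simp only [hH]
    split_ifs with h
    · linarith
    · linarith [Real.exp_pos ((x₀ - γ * m) / 2)]
  linarith

/-- The square of 7/12 slightly exceeds 1/3, the leading coefficient of the sum of squares. -/
theorem sum_range_succ_sq_le (n : ℕ) :
    ∑ m ∈ Finset.range n, ((m : ℝ) + 1) ^ 2 ≤ n * (7 / 12 * ((n : ℝ) + 1)) ^ 2 := by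
  have h : ∑ m ∈ Finset.range n, ((m : ℝ) + 1) ^ 2
      = (n : ℝ) * (n + 1) * (2 * n + 1) / 6 := by
    induction n with
    | zero => simp
    | succ n ih => rw [Finset.sum_range_succ, ih]; push_cast; ring
  rw [h]
  have hn : (0 : ℝ) ≤ n := Nat.cast_nonneg n
  have : (n : ℝ) * (7 / 12 * ((n : ℝ) + 1)) ^ 2 - n * (n + 1) * (2 * n + 1) / 6
      = n * (n + 1) * (n + 25) / 144 := by ring
  have : (0 : ℝ) ≤ n * (n + 1) * (n + 25) / 144 := by positivity
  linarith

theorem exp_neg_twelve_sevenths_mul_log_two_le :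
    Real.exp (-(12 / 7 * Real.log 2)) ≤ 1 - Real.log 2 := by
  have h1 : Real.exp (-(12 / 7 * Real.log 2)) ^ 7 = 1 / 4096 := by
    rw [← Real.exp_nat_mul]
    have : ((7 : ℕ) : ℝ) * -(12 / 7 * Real.log 2) = -((12 : ℕ) * Real.log 2) := by
      push_cast; ring
    rw [this, Real.exp_neg, Real.exp_nat_mul, Real.exp_log (by norm_num)]
    norm_num
  have h2 : Real.exp (-(12 / 7 * Real.log 2)) ≤ 0.3068 := by
    refine le_of_pow_le_pow_left₀ (n := 7) (by norm_num) (by norm_num) ?_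
    rw [h1]; norm_num
  linarith [Real.log_two_lt_d9]

/-- With `α = γ log 2 / B` and `z = (n + 1) α`, the ratio `G` is at least `(1 - exp (-z)) / α`. For
large `z` this exceeds `B / γ`, which bounds every `s m`. For small `z` it exceeds `7 / 12 * (n +
1)`, and `s m ≤ m + 1` suffices. The two lower bounds agree at `z = 12 / 7 * log 2`, where the cases
split. -/
theorem sum_sq_le_mul_sq_geom {n : ℕ} {γ B : ℝ} (hγ : 0 < γ) (hB : 0 < B)
    {s : ℕ → ℝ} (hs0 : ∀ m, 0 ≤ s m) (hs : ∀ m : ℕ, s m ≤ m + 1) (hsB : ∀ m, γ * s m ≤ B) :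
    ∑ m ∈ Finset.range n, s m ^ 2
      ≤ n * ((1 - (1 / 2 : ℝ) ^ (((n : ℝ) + 1) * B⁻¹ * γ))
          / (1 - (1 / 2 : ℝ) ^ (B⁻¹ * γ))) ^ 2 := by
  have hl2 : 0 < Real.log 2 := Real.log_pos one_lt_two
  set α := Real.log 2 * γ / B with hα
  have hα0 : 0 < α := by positivity
  have hpow : ∀ x : ℝ, (1 / 2 : ℝ) ^ (x * B⁻¹ * γ) = Real.exp (-(x * α)) := by
    intro x
    rw [Real.rpow_def_of_pos (by norm_num), one_div, Real.log_inv]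
    congr 1; rw [hα]; ring
  have hpow1 : (1 / 2 : ℝ) ^ (B⁻¹ * γ) = Real.exp (-α) := by simpa using hpow 1
  rw [hpow, hpow1]
  set z := ((n : ℝ) + 1) * α with hz
  have hz0 : 0 < z := by positivity
  have hden0 : 0 < 1 - Real.exp (-α) := by
    have : Real.exp (-α) < 1 := Real.exp_zero ▸ Real.exp_lt_exp.2 (by linarith)
    linarith
  have hG : (1 - Real.exp (-z)) / α ≤ (1 - Real.exp (-z)) / (1 - Real.exp (-α)) := by
    refine div_le_div_of_nonneg_left ?_ hden0 (by linarith [Real.one_sub_le_exp_neg α])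
    have : Real.exp (-z) < 1 := Real.exp_zero ▸ Real.exp_lt_exp.2 (by linarith)
    linarith
  set G := (1 - Real.exp (-z)) / (1 - Real.exp (-α))
  have hκ := exp_neg_twelve_sevenths_mul_log_two_le
  rcases le_total (12 / 7 * Real.log 2) z with h | h
  · have hGB : B / γ ≤ G := by
      refine le_trans ?_ hG
      have h1 : Real.exp (-z) ≤ 1 - Real.log 2 := (Real.exp_le_exp.2 (by linarith)).trans hκ
      have h2 : B / γ = Real.log 2 / α := by rw [hα]; field_simp
      rw [h2]
      exact div_le_div_of_nonneg_right (by linarith) hα0.le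
    calc ∑ m ∈ Finset.range n, s m ^ 2 ≤ ∑ m ∈ Finset.range n, G ^ 2 :=
          Finset.sum_le_sum fun m _ => pow_le_pow_left₀ (hs0 m)
            (((le_div_iff₀' hγ).2 (hsB m)).trans hGB) 2
      _ = _ := by simp
  · set r := z / (12 / 7 * Real.log 2) with hr
    have hr0 : 0 ≤ r := by positivity
    have hr1 : r ≤ 1 := (div_le_one (by positivity)).2 h
    -- The exponential lies below its chord between `-(12 / 7) log 2` and 0.
    have hconv := convexOn_exp.2 (Set.mem_univ 0) (Set.mem_univ (-(12 / 7 * Real.log 2)))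
      (sub_nonneg.2 hr1) hr0 (by ring)
    simp only [smul_eq_mul, mul_zero, zero_add, Real.exp_zero, mul_one] at hconv
    have h1 : r * -(12 / 7 * Real.log 2) = -z := by rw [hr]; field_simp
    rw [h1] at hconv
    have h2 : r * Real.log 2 ≤ 1 - Real.exp (-z) := by
      nlinarith [mul_le_mul_of_nonneg_left hκ hr0]
    have hGn : 7 / 12 * ((n : ℝ) + 1) ≤ G := by
      refine le_trans ?_ hG
      rw [le_div_iff₀ hα0]
      refine le_trans (le_of_eq ?_) h2
      rw [hr, hz]; field_simp
    calc ∑ m ∈ Finset.range n, s m ^ 2 ≤ ∑ m ∈ Finset.range n, ((m : ℝ) + 1) ^ 2 :=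
          Finset.sum_le_sum fun m _ => pow_le_pow_left₀ (hs0 m) (hs m) 2
      _ ≤ _ := sum_range_succ_sq_le n
      _ ≤ _ := mul_le_mul_of_nonneg_left (pow_le_pow_left₀ (by positivity) hGn 2)
          (Nat.cast_nonneg n)

end Numeric

/-! ### Change of measure and Hoeffding's lemma -/

section PACBayes

open InformationTheory

/-- Donsker–Varadhan: the divergence of `ρ` from `μ` tilted by `φ` is nonnegative. -/
theorem integral_le_toReal_klDiv_add_log_integral_exp {Θ : Type*} [MeasurableSpace Θ]
    {μ ρ : Measure Θ} [IsProbabilityMeasure μ] [IsProbabilityMeasure ρ] (hkl : klDiv ρ μ ≠ ⊤)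
    {φ : Θ → ℝ} (hφ : Integrable φ ρ) (hexp : Integrable (fun θ => Real.exp (φ θ)) μ) :
    ∫ θ, φ θ ∂ρ ≤ (klDiv ρ μ).toReal + Real.log (∫ θ, Real.exp (φ θ) ∂μ) := by
  obtain ⟨hac, hint⟩ := klDiv_ne_top_iff.1 hkl
  have hprob : IsProbabilityMeasure (μ.tilted φ) := isProbabilityMeasure_tilted hexp
  have h1 := integral_llr_add_sub_measure_univ_nonneg
    (hac.trans (absolutelyContinuous_tilted hexp)) (integrable_llr_tilted_right hac hφ hint hexp)
  rw [integral_llr_tilted_right hac hφ hexp hint] at h1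
  rw [toReal_klDiv_of_measure_eq hac (by simp)]
  simp only [probReal_univ] at h1
  linarith

/-- Catoni-type PAC-Bayes inequality from a uniform bound on exponential moments. -/
theorem exists_event_forall_integral_le_klDiv {Θ Ω : Type*} [MeasurableSpace Θ]
    [MeasurableSpace Ω] {μ : Measure Θ} [IsProbabilityMeasure μ] {Pr : Measure Ω}
    [IsProbabilityMeasure Pr] {g : Θ × Ω → ℝ} (hg : Measurable g) {b : ℝ} (hb : ∀ x, |g x| ≤ b)
    {κ : ℝ} (hκ : ∀ θ, ∫ ω, Real.exp (g (θ, ω)) ∂Pr ≤ Real.exp κ)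
    {δ : ℝ} (hδ : 0 < δ) :
    ∃ E : Set Ω, MeasurableSet E ∧ 1 - δ ≤ Pr.real E ∧
      ∀ ω ∈ E, ∀ ρ : Measure Θ, IsProbabilityMeasure ρ → klDiv ρ μ ≠ ⊤ →
        ∫ θ, g (θ, ω) ∂ρ ≤ (klDiv ρ μ).toReal + κ + Real.log (1 / δ) := by
  have hexp_bound : ∀ x, ‖Real.exp (g x)‖ ≤ Real.exp b := fun x => by
    rw [Real.norm_eq_abs, Real.abs_exp]
    exact Real.exp_le_exp.2 ((le_abs_self _).trans (hb x))
  have hprod : Integrable (fun x => Real.exp (g x)) (μ.prod Pr) :=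
    Integrable.of_bound hg.exp.aestronglyMeasurable _ (Filter.Eventually.of_forall hexp_bound)
  set F : Ω → ℝ := fun ω => ∫ θ, Real.exp (g (θ, ω)) ∂μ with hF
  have hFm : Measurable F := hg.exp.stronglyMeasurable.integral_prod_left'.measurable
  have hF0 : ∀ ω, 0 ≤ F ω := fun ω => integral_nonneg fun θ => (Real.exp_pos _).le
  have hFint : Integrable F Pr := hprod.integral_prod_right
  have hFle : ∫ ω, F ω ∂Pr ≤ Real.exp κ := by
    have h1 : ∫ ω, F ω ∂Pr = ∫ θ, ∫ ω, Real.exp (g (θ, ω)) ∂Pr ∂μ :=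
      (integral_integral_swap hprod).symm
    rw [h1]
    calc _ ≤ ∫ _, Real.exp κ ∂μ :=
          integral_mono hprod.integral_prod_left (integrable_const _) hκ
      _ = _ := by simp
  have hmeasE : MeasurableSet {ω | F ω ≤ Real.exp κ / δ} := measurableSet_le hFm measurable_const
  -- Markov's inequality for `F` at this level gives probability `1 - δ`. The event involves only
  -- the prior, so it serves all `ρ` at once.
  refine ⟨{ω | F ω ≤ Real.exp κ / δ}, hmeasE, ?_, ?_⟩
  · have h1 := mul_meas_ge_le_integral_of_nonneg (Filter.Eventually.of_forall hF0) hFint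
      (Real.exp κ / δ)
    have h2 : Pr.real {ω | Real.exp κ / δ ≤ F ω} ≤ δ := by
      have h3 := h1.trans hFle
      rw [div_mul_eq_mul_div, div_le_iff₀ hδ] at h3
      exact le_of_mul_le_mul_left h3 (Real.exp_pos κ)
    have h3 : Pr.real {ω | F ω ≤ Real.exp κ / δ}ᶜ ≤ Pr.real {ω | Real.exp κ / δ ≤ F ω} :=
      measureReal_mono fun ω hω => (not_le.1 (show ¬ F ω ≤ Real.exp κ / δ from hω)).le
    rw [probReal_compl_eq_one_sub hmeasE] at h3
    linarith
  · intro ω hω ρ hρ hkl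
    have hgω : Measurable fun θ => g (θ, ω) := hg.comp (by fun_prop)
    have h1 := integral_le_toReal_klDiv_add_log_integral_exp hkl
      (φ := fun θ => g (θ, ω))
      (Integrable.of_bound hgω.aestronglyMeasurable b
        (Filter.Eventually.of_forall fun θ => hb _))
      (Integrable.of_bound hgω.exp.aestronglyMeasurable _
        (Filter.Eventually.of_forall fun θ => hexp_bound _))
    have hFpos : 0 < F ω := integral_exp_pos (Integrable.of_bound
      hgω.exp.aestronglyMeasurable _ (Filter.Eventually.of_forall fun θ => hexp_bound _))
    have h2 : Real.log (F ω) ≤ κ + Real.log (1 / δ) := by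
      refine (Real.log_le_log hFpos hω).trans (le_of_eq ?_)
      rw [div_eq_mul_one_div, Real.log_mul (Real.exp_pos κ).ne' (by positivity), Real.log_exp]
    linarith

/-- Hoeffding's lemma for a bounded function in terms of its oscillation. -/
theorem integral_exp_neg_mul_le_of_sub_le {Z : Type*} [MeasurableSpace Z] {ν : Measure Z}
    [IsProbabilityMeasure ν] {X : Z → ℝ} (hX : Measurable X) {d : ℝ}
    (hd : ∀ z z', X z - X z' ≤ d) (l : ℝ) :
    ∫ z, Real.exp (-(l * X z)) ∂ν ≤ Real.exp (-(l * ∫ z, X z ∂ν) + l ^ 2 * d ^ 2 / 8) := by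
  have : Nonempty Z := nonempty_of_isProbabilityMeasure ν
  set a := ⨅ z, X z with ha
  have hbdd : BddBelow (Set.range X) := by
    obtain ⟨z₀⟩ := this
    refine ⟨X z₀ - d, ?_⟩
    rintro _ ⟨z, rfl⟩
    linarith [hd z₀ z]
  have hmem : ∀ z, X z ∈ Set.Icc a (a + d) := fun z =>
    ⟨ciInf_le hbdd z, by
      have : X z - d ≤ a := le_ciInf fun z' => by linarith [hd z z']
      linarith⟩
  have h := (hasSubgaussianMGF_of_mem_Icc (μ := ν) hX.aemeasurable
    (Filter.Eventually.of_forall hmem)).mgf_le (-l)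
  rw [mgf] at h
  have h1 : ∀ z, Real.exp (-(l * X z))
      = Real.exp (-(l * ∫ z, X z ∂ν)) * Real.exp (-l * (X z - ∫ z, X z ∂ν)) := fun z => by
    rw [← Real.exp_add]; congr 1; ring
  simp only [h1]
  rw [integral_const_mul, Real.exp_add]
  refine mul_le_mul_of_nonneg_left (h.trans (le_of_eq ?_)) (Real.exp_pos _).le
  congr 1
  simp only [add_sub_cancel_left, NNReal.coe_pow, NNReal.coe_div, coe_nnnorm, Real.norm_eq_abs,
    NNReal.coe_ofNat, div_pow, sq_abs]
  ring

end PACBayes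

/-! ### The martingale method along the sample -/

section MarkovSample

open Matrix

theorem integral_eq_integral_of_hasCondDistrib {Ω 𝒳 𝒵 : Type*} [MeasurableSpace Ω]
    [MeasurableSpace 𝒳] [MeasurableSpace 𝒵] {Pr : Measure Ω} [IsProbabilityMeasure Pr]
    {X : Ω → 𝒳} {Z : Ω → 𝒵} {κ : Kernel 𝒳 𝒵} [IsMarkovKernel κ] (h : HasCondDistrib Z X κ Pr)
    {Φ : 𝒳 × 𝒵 → ℝ} (hΦ : Measurable Φ) {b : ℝ} (hb : ∀ x, |Φ x| ≤ b) :
    ∫ ω, Φ (X ω, Z ω) ∂Pr = ∫ ω, ∫ z, Φ (X ω, z) ∂κ (X ω) ∂Pr := by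
  have hX := h.aemeasurable_fst
  have hprob : IsProbabilityMeasure (Pr.map X) := Measure.isProbabilityMeasure_map hX
  rw [← integral_map (φ := fun ω => (X ω, Z ω)) h.aemeasurable hΦ.aestronglyMeasurable, h.map_eq,
    Measure.integral_compProd (Integrable.of_bound hΦ.aestronglyMeasurable b
      (Filter.Eventually.of_forall hb)),
    integral_map hX (hΦ.stronglyMeasurable.integral_kernel_prod_right').aestronglyMeasurable]

variable {𝒰 𝒴 Ω : Type*} [MeasurableSpace 𝒰] [MeasurableSpace 𝒴] [MeasurableSpace Ω]

instance isMarkovKernel_pairKernel (P : Kernel 𝒰 𝒰) [IsMarkovKernel P] (Q : Kernel 𝒰 𝒴)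
    [IsMarkovKernel Q] : IsMarkovKernel (pairKernel P Q) := by
  unfold pairKernel; infer_instance

theorem integral_pairKernel (P : Kernel 𝒰 𝒰) [IsMarkovKernel P] (Q : Kernel 𝒰 𝒴)
    [IsMarkovKernel Q] {G : 𝒰 × 𝒴 → ℝ} (hG : Measurable G) {b : ℝ} (hb : ∀ z, |G z| ≤ b)
    (z : 𝒰 × 𝒴) :
    ∫ z', G z' ∂pairKernel P Q z = ∫ u, ∫ y, G (u, y) ∂Q u ∂P z.1 := by
  have h : pairKernel P Q z = P.compProd (Kernel.prodMkLeft 𝒰 Q) z.1 := rfl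
  rw [h, ProbabilityTheory.integral_compProd (Integrable.of_bound hG.aestronglyMeasurable b
      (Filter.Eventually.of_forall hb))]
  rfl

variable {P : Kernel 𝒰 𝒰} {Q : Kernel 𝒰 𝒴} {p : Measure 𝒰} {n : ℕ} {U : ℕ → Ω → 𝒰}
  {Y : ℕ → Ω → 𝒴} {Pr : Measure Ω}

theorem aemeasurable_sample (hS : IsStationarySample P Q p n U Y Pr) {t : ℕ} (ht : t < n) :
    AEMeasurable (fun ω => (U t ω, Y t ω)) Pr := by
  cases t with
  | zero => exact (hS.initial ht).aemeasurable
  | succ t => exact (hS.step t ht).aemeasurable_snd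

variable [IsMarkovKernel P] [IsMarkovKernel Q] [IsProbabilityMeasure Pr]

theorem integral_sample_step (hS : IsStationarySample P Q p n U Y Pr) {t : ℕ} (ht : t + 1 < n)
    {Φ : (Fin (t + 1) → 𝒰 × 𝒴) × (𝒰 × 𝒴) → ℝ} (hΦ : Measurable Φ) {b : ℝ}
    (hb : ∀ x, |Φ x| ≤ b) :
    ∫ ω, Φ (fun s => (U s ω, Y s ω), (U (t + 1) ω, Y (t + 1) ω)) ∂Pr
      = ∫ ω, ∫ z, Φ (fun s => (U s ω, Y s ω), z) ∂pairKernel P Q (U t ω, Y t ω) ∂Pr :=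
  integral_eq_integral_of_hasCondDistrib (hS.step t ht) hΦ hb

variable [Fintype 𝒰]

/-- The expected sum of the next `m` values of `h` along the chain. -/
noncomputable def futureSum {S : Type*} [Fintype S] (A : Matrix S S ℝ) (h : S → ℝ) : ℕ → S → ℝ
  | 0 => 0
  | m + 1 => A *ᵥ (h + futureSum A h m)

theorem futureSum_eq_sum {S : Type*} [Fintype S] [DecidableEq S] (A : Matrix S S ℝ) (h : S → ℝ) (m : ℕ) :
    futureSum A h m = ∑ k ∈ Finset.range m, A ^ (k + 1) *ᵥ h := by
  induction m with
  | zero => rfl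
  | succ m ih =>
    rw [futureSum, ih, mulVec_add, Finset.sum_range_succ', Matrix.mulVec_sum, add_comm]
    congr 1
    · exact Finset.sum_congr rfl fun k _ => by rw [mulVec_mulVec, ← pow_succ']
    · simp

theorem exists_abs_futureSum_le {S : Type*} [Fintype S] (A : Matrix S S ℝ) (h : S → ℝ) (m : ℕ) :
    ∃ b, ∀ u, |futureSum A h m u| ≤ b := by
  refine ⟨∑ u, |futureSum A h m u|, fun u => ?_⟩
  exact Finset.single_le_sum (f := fun u => |futureSum A h m u|) (fun _ _ => abs_nonneg _)
    (Finset.mem_univ u)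

theorem integral_transitionKernel [MeasurableSingletonClass 𝒰] (P : Kernel 𝒰 𝒰) [IsMarkovKernel P]
    (h : 𝒰 → ℝ) (u : 𝒰) :
    ∫ v, h v ∂P u = (transitionMatrix P *ᵥ h) u := by
  rw [integral_fintype (Integrable.of_finite)]
  rfl

variable [MeasurableSingletonClass 𝒰] {g : 𝒰 × 𝒴 → ℝ} {c : ℝ}

/-- The martingale identity: averaging over the label replaces `g` by `h`, and averaging over the
object applies the transition matrix, which is the recursion of `futureSum`. -/
theorem integral_pairKernel_add_futureSum (hg : Measurable g) (hgc : ∀ z, g z ∈ Set.Icc 0 c)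
    (m : ℕ) (z : 𝒰 × 𝒴) :
    ∫ z', (g z' + futureSum (transitionMatrix P) (fun u => ∫ y, g (u, y) ∂Q u) m z'.1)
        ∂pairKernel P Q z
      = futureSum (transitionMatrix P) (fun u => ∫ y, g (u, y) ∂Q u) (m + 1) z.1 := by
  set h : 𝒰 → ℝ := fun u => ∫ y, g (u, y) ∂Q u with hh
  set a := futureSum (transitionMatrix P) h m
  have ham : Measurable a := .of_discrete
  obtain ⟨b, hb⟩ := exists_abs_futureSum_le (transitionMatrix P) h m
  have hgam : Measurable fun z : 𝒰 × 𝒴 => g z + a z.1 := hg.add (ham.comp measurable_fst)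
  rw [integral_pairKernel P Q hgam (b := c + b)
    fun z => (abs_add_le _ _).trans (add_le_add (abs_le.2 ⟨by linarith [(hgc z).1, (hgc z).2],
      (hgc z).2⟩) (hb _)), futureSum, ← integral_transitionKernel]
  congr 1; ext u
  have hgu : Measurable fun y => g (u, y) := hg.comp (by fun_prop)
  change ∫ y, (g (u, y) + a u) ∂Q u = _
  rw [integral_add (Integrable.of_mem_Icc 0 c hgu.aemeasurable
    (Filter.Eventually.of_forall fun y => hgc _)) (integrable_const _)]
  simp [hh, a]

theorem integral_partial_sum_add_futureSum (hS : IsStationarySample P Q p n U Y Pr)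
    (hg : Measurable g) (hgc : ∀ z, g z ∈ Set.Icc 0 c) (m t : ℕ) (htm : t + 1 + m = n) :
    ∫ ω, ∑ s ∈ Finset.range n, g (U s ω, Y s ω) ∂Pr
      = ∫ ω, (∑ s ∈ Finset.range (t + 1), g (U s ω, Y s ω)
        + futureSum (transitionMatrix P) (fun u => ∫ y, g (u, y) ∂Q u) m (U t ω)) ∂Pr := by
  set h : 𝒰 → ℝ := fun u => ∫ y, g (u, y) ∂Q u with hh
  induction m generalizing t with
  | zero => subst htm; simp [futureSum]
  | succ m ih =>
    rw [ih (t + 1) (by omega)]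
    set a := futureSum (transitionMatrix P) h m with ha
    have ham : Measurable a := .of_discrete
    obtain ⟨b, hb⟩ := exists_abs_futureSum_le (transitionMatrix P) h m
    have habs : ∀ z, |g z| ≤ c := fun z =>
      abs_le.2 ⟨by linarith [(hgc z).1, (hgc z).2], (hgc z).2⟩
    have hstep := integral_sample_step hS (t := t) (by omega)
      (Φ := fun x => ∑ s, g (x.1 s) + (g x.2 + a x.2.1))
      (by
        refine Measurable.add (Finset.measurable_sum _ fun s _ => hg.comp (by fun_prop))
          ((hg.comp measurable_snd).add (ham.comp (by fun_prop))))
      (b := (t + 1 : ℕ) * c + (c + b))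
      (fun x => by
        refine (abs_add_le _ _).trans (add_le_add ?_ ((abs_add_le _ _).trans
          (add_le_add (habs _) (hb _))))
        refine (Finset.abs_sum_le_sum_abs _ _).trans
          ((Finset.sum_le_sum fun s _ => habs _).trans (by simp)))
    simp only at hstep
    have hrange : ∀ ω, ∑ s : Fin (t + 1), g (U s ω, Y s ω)
        = ∑ s ∈ Finset.range (t + 1), g (U s ω, Y s ω) := fun ω =>
      Fin.sum_univ_eq_sum_range (fun s => g (U s ω, Y s ω)) (t + 1)
    simp only [hrange] at hstep
    calc _ = ∫ ω, (∑ s ∈ Finset.range (t + 1), g (U s ω, Y s ω)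
            + (g (U (t + 1) ω, Y (t + 1) ω) + a (U (t + 1) ω))) ∂Pr := by
          congr 1; ext ω; rw [Finset.sum_range_succ _ (t + 1), add_assoc]
      _ = _ := hstep
      _ = _ := by
        congr 1; ext ω
        have hgam : Measurable fun z : 𝒰 × 𝒴 => g z + a z.1 := hg.add (ham.comp measurable_fst)
        rw [integral_add (integrable_const _) (Integrable.of_bound
          hgam.aestronglyMeasurable (c + b)
          (Filter.Eventually.of_forall fun z => (abs_add_le _ _).trans
            (add_le_add (habs _) (hb _)))), integral_pairKernel_add_futureSum hg hgc]
        simp [hh]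

/-- Backward induction as for the mean; integrating out a pair followed by `m` others costs `exp (l²
* d m ^ 2 / 8)` by Hoeffding's lemma under the conditional law. -/
theorem integral_exp_partial_sum_le (hS : IsStationarySample P Q p n U Y Pr)
    (hg : Measurable g) (hgc : ∀ z, g z ∈ Set.Icc 0 c) {d : ℕ → ℝ}
    (hd : ∀ m z z', (g z + futureSum (transitionMatrix P) (fun u => ∫ y, g (u, y) ∂Q u) m z.1)
      - (g z' + futureSum (transitionMatrix P) (fun u => ∫ y, g (u, y) ∂Q u) m z'.1) ≤ d m)
    (l : ℝ) (m t : ℕ) (htm : t + 1 + m = n) :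
    ∫ ω, Real.exp (-(l * ∑ s ∈ Finset.range n, g (U s ω, Y s ω))) ∂Pr
      ≤ Real.exp (l ^ 2 / 8 * ∑ i ∈ Finset.range m, d i ^ 2)
        * ∫ ω, Real.exp (-(l * (∑ s ∈ Finset.range (t + 1), g (U s ω, Y s ω)
        + futureSum (transitionMatrix P) (fun u => ∫ y, g (u, y) ∂Q u) m (U t ω)))) ∂Pr := by
  set h : 𝒰 → ℝ := fun u => ∫ y, g (u, y) ∂Q u with hh
  induction m generalizing t with
  | zero => subst htm; simp [futureSum]
  | succ m ih =>
    refine (ih (t + 1) (by omega)).trans ?_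
    rw [Finset.sum_range_succ, mul_add, Real.exp_add, mul_assoc]
    refine mul_le_mul_of_nonneg_left ?_ (Real.exp_pos _).le
    set a := futureSum (transitionMatrix P) h m with ha
    have ham : Measurable a := .of_discrete
    obtain ⟨b, hb⟩ := exists_abs_futureSum_le (transitionMatrix P) h m
    obtain ⟨b', hb'⟩ := exists_abs_futureSum_le (transitionMatrix P) h (m + 1)
    have habs : ∀ z, |g z| ≤ c := fun z =>
      abs_le.2 ⟨by linarith [(hgc z).1, (hgc z).2], (hgc z).2⟩
    have hexp : ∀ x y : ℝ, |x| ≤ y → Real.exp (-(l * x)) ≤ Real.exp (|l| * y) := fun x y hxy =>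
      Real.exp_le_exp.2 ((neg_le_abs _).trans (by
        rw [abs_mul]; exact mul_le_mul_of_nonneg_left hxy (abs_nonneg _)))
    have hga : ∀ z : 𝒰 × 𝒴, |g z + a z.1| ≤ c + b := fun z =>
      (abs_add_le _ _).trans (add_le_add (habs _) (hb _))
    have hgam : Measurable fun z : 𝒰 × 𝒴 => g z + a z.1 := hg.add (ham.comp measurable_fst)
    have hsumabs : ∀ ω, |∑ s ∈ Finset.range (t + 1), g (U s ω, Y s ω)| ≤ (t + 1 : ℕ) * c :=
      fun ω => (Finset.abs_sum_le_sum_abs _ _).trans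
          ((Finset.sum_le_sum fun s _ => habs _).trans (by simp))
    have hstep := integral_sample_step hS (t := t) (by omega)
      (Φ := fun x => Real.exp (-(l * ∑ s, g (x.1 s))) * Real.exp (-(l * (g x.2 + a x.2.1))))
      (by
        refine Measurable.mul (Measurable.exp ((Measurable.const_mul (Finset.measurable_sum _
          fun s _ => hg.comp (by fun_prop)) l).neg)) (Measurable.exp
          (((hgam.comp measurable_snd).const_mul l).neg)))
      (b := Real.exp (|l| * ((t + 1 : ℕ) * c)) * Real.exp (|l| * (c + b)))
      (fun x => by
        rw [abs_mul, Real.abs_exp, Real.abs_exp]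
        refine mul_le_mul (hexp _ _ ?_) (hexp _ _ (hga _)) (Real.exp_pos _).le (Real.exp_pos _).le
        exact (Finset.abs_sum_le_sum_abs _ _).trans
          ((Finset.sum_le_sum fun s _ => habs _).trans (by simp)))
    simp only at hstep
    have hrange : ∀ ω, ∑ s : Fin (t + 1), g (U s ω, Y s ω)
        = ∑ s ∈ Finset.range (t + 1), g (U s ω, Y s ω) := fun ω =>
      Fin.sum_univ_eq_sum_range (fun s => g (U s ω, Y s ω)) (t + 1)
    simp only [hrange, integral_const_mul] at hstep
    have hsample : ∀ s ≤ t, AEMeasurable (fun ω => (U s ω, Y s ω)) Pr := fun s hs =>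
      aemeasurable_sample hS (by omega)
    have hsum_meas : AEMeasurable (fun ω => ∑ s ∈ Finset.range (t + 1), g (U s ω, Y s ω)) Pr :=
      Finset.aemeasurable_fun_sum _ fun s hs =>
        hg.comp_aemeasurable (hsample s (by have := Finset.mem_range.1 hs; omega))
    set a' := futureSum (transitionMatrix P) h (m + 1) with ha'
    have ham' : Measurable a' := .of_discrete
    have hpt : ∀ ω, ∫ z, Real.exp (-(l * (g z + a z.1))) ∂pairKernel P Q (U t ω, Y t ω)
        ≤ Real.exp (-(l * a' (U t ω))) * Real.exp (l ^ 2 / 8 * d m ^ 2) := by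
      intro ω
      refine (integral_exp_neg_mul_le_of_sub_le hgam (hd m) l).trans (le_of_eq ?_)
      rw [integral_pairKernel_add_futureSum hg hgc, ← Real.exp_add]
      congr 1; simp only [ha']; ring
    calc _ = ∫ ω, Real.exp (-(l * ∑ s ∈ Finset.range (t + 1), g (U s ω, Y s ω)))
            * Real.exp (-(l * (g (U (t + 1) ω, Y (t + 1) ω) + a (U (t + 1) ω)))) ∂Pr := by
          congr 1; ext ω; rw [Finset.sum_range_succ _ (t + 1), ← Real.exp_add]; congr 1; ring
      _ = _ := hstep
      _ ≤ ∫ ω, Real.exp (l ^ 2 / 8 * d m ^ 2)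
            * Real.exp (-(l * (∑ s ∈ Finset.range (t + 1), g (U s ω, Y s ω) + a' (U t ω)))) ∂Pr := by
          refine integral_mono_of_nonneg (Filter.Eventually.of_forall fun ω =>
            mul_nonneg (Real.exp_pos _).le (integral_nonneg fun z => (Real.exp_pos _).le)) ?_
            (Filter.Eventually.of_forall fun ω => ?_)
          · refine Integrable.const_mul (Integrable.of_bound (C := Real.exp (|l| *
              ((t + 1 : ℕ) * c + b'))) ?_ (Filter.Eventually.of_forall fun ω => ?_)) _
            · exact (((hsum_meas.add (ham'.comp_aemeasurable
                (hsample t le_rfl).fst)).const_mul l).neg.exp).aestronglyMeasurable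
            · rw [Real.norm_eq_abs, Real.abs_exp]
              exact hexp _ _ ((abs_add_le _ _).trans (add_le_add (hsumabs ω) (hb' _)))
          · refine (mul_le_mul_of_nonneg_left (hpt ω) (Real.exp_pos _).le).trans (le_of_eq ?_)
            simp only
            rw [← Real.exp_add, ← Real.exp_add, ← Real.exp_add]
            congr 1; ring
      _ = _ := integral_const_mul _ _

/-- Exponential moment bound for sums along a Markov sample, in terms of the oscillations of the
conditional expected remaining sums. -/
theorem integral_exp_sub_sum_le (hS : IsStationarySample P Q p n U Y Pr) (hn : 1 ≤ n)
    (hg : Measurable g) (hgc : ∀ z, g z ∈ Set.Icc 0 c) {d : ℕ → ℝ}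
    (hd : ∀ m z z', (g z + futureSum (transitionMatrix P) (fun u => ∫ y, g (u, y) ∂Q u) m z.1)
      - (g z' + futureSum (transitionMatrix P) (fun u => ∫ y, g (u, y) ∂Q u) m z'.1) ≤ d m)
    (l : ℝ) :
    ∫ ω, Real.exp (l * (∫ ω', ∑ s ∈ Finset.range n, g (U s ω', Y s ω') ∂Pr
        - ∑ s ∈ Finset.range n, g (U s ω, Y s ω))) ∂Pr
      ≤ Real.exp (l ^ 2 / 8 * ∑ i ∈ Finset.range n, d i ^ 2) := by
  obtain ⟨m, rfl⟩ : ∃ m, n = 0 + 1 + m := ⟨n - 1, by omega⟩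
  have h1 := integral_exp_partial_sum_le hS hg hgc hd l m 0 rfl
  have h2 := integral_partial_sum_add_futureSum hS hg hgc m 0 rfl
  set M := ∫ ω, ∑ s ∈ Finset.range (0 + 1 + m), g (U s ω, Y s ω) ∂Pr
  set h : 𝒰 → ℝ := fun u => ∫ y, g (u, y) ∂Q u with hh
  set a := futureSum (transitionMatrix P) h m with ha
  have ham : Measurable a := .of_discrete
  have hgam : Measurable fun z : 𝒰 × 𝒴 => g z + a z.1 := hg.add (ham.comp measurable_fst)
  have hexpm : Measurable fun z : 𝒰 × 𝒴 => Real.exp (-(l * (g z + a z.1))) :=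
    (hgam.const_mul l).neg.exp
  have hlaw := aemeasurable_sample hS (t := 0) (by omega)
  have hprob := Measure.isProbabilityMeasure_map hlaw
  -- The `n - 1` conditional steps leave only the first pair. Hoeffding's lemma under its own law
  -- supplies the last term `d m`.
  have h3 := integral_exp_neg_mul_le_of_sub_le
    (ν := Pr.map fun ω => (U 0 ω, Y 0 ω)) hgam (hd m) l
  rw [integral_map hlaw hgam.aestronglyMeasurable,
    integral_map hlaw hexpm.aestronglyMeasurable] at h3
  simp only [zero_add, Finset.range_one, Finset.sum_singleton] at h1 h2
  simp only at h3
  rw [← h2] at h3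
  have h4 : ∀ ω, Real.exp (l * (M - ∑ s ∈ Finset.range (0 + 1 + m), g (U s ω, Y s ω)))
      = Real.exp (l * M) * Real.exp (-(l * ∑ s ∈ Finset.range (0 + 1 + m), g (U s ω, Y s ω))) :=
    fun ω => by rw [← Real.exp_add]; congr 1; ring
  simp only [h4, integral_const_mul]
  rw [zero_add]
  calc _ ≤ Real.exp (l * M) * (Real.exp (l ^ 2 / 8 * ∑ i ∈ Finset.range m, d i ^ 2)
        * Real.exp (-(l * M) + l ^ 2 * d m ^ 2 / 8)) := by
        refine mul_le_mul_of_nonneg_left (h1.trans ?_) (Real.exp_pos _).le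
        exact mul_le_mul_of_nonneg_left h3 (Real.exp_pos _).le
    _ = _ := by
      rw [← Real.exp_add, ← Real.exp_add, add_comm 1 m, Finset.sum_range_succ]
      congr 1; ring

end MarkovSample

/-! ### Summable oscillation rates -/

section MixingRate

open Matrix

variable {S : Type*} [Fintype S] [DecidableEq S]

theorem pseudoSpectralGap_le_one {p : S → ℝ} (hp : ∀ u, 0 < p u) (A : Matrix S S ℝ) :
    pseudoSpectralGap p A ≤ 1 := by
  refine csSup_le ⟨_, 1, le_rfl, rfl⟩ ?_
  rintro _ ⟨k, hk, rfl⟩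
  have hk1 : (1 : ℝ) ≤ k := by exact_mod_cast hk
  rw [timeReversal_pow hp, div_le_one (by linarith)]
  exact (spectralGap_timeReversal_mul_le_one hp _).trans hk1

theorem one_le_log_one_div_add {m : ℝ} (hm0 : 0 < m) (hm1 : m ≤ 1) :
    1 ≤ Real.log (1 / m) + 2 * Real.log 2 + 1 := by
  have h1 : 0 ≤ Real.log (1 / m) := Real.log_nonneg ((one_le_div hm0).2 hm1)
  have h2 : 0 < Real.log 2 := Real.log_pos one_lt_two
  linarith

/-- The rate is the decay factor of `abs_pow_mulVec_sub_le`. The normalization `τ 0 = 1` is needed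
because lag 0 must pay for the loss itself, whose label is random even when the object is known. -/
theorem exists_oscillation_rate [Nonempty S] {p : S → ℝ} (hp : ∀ u, 0 < p u)
    (hp1 : ∑ u, p u = 1) {A : Matrix S S ℝ} (hA0 : ∀ u v, 0 ≤ A u v) (hA : A *ᵥ 1 = 1)
    (hpA : p ᵥ* A = p) (hγ : 0 < pseudoSpectralGap p A) {m : ℝ} (hm : 0 < m)
    (hmp : ∀ u, m ≤ p u) :
    ∃ τ : ℕ → ℝ, τ 0 = 1 ∧ (∀ k, 0 ≤ τ k) ∧ (∀ k, τ k ≤ 1) ∧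
      (∀ N, pseudoSpectralGap p A * ∑ k ∈ Finset.range N, τ k
        ≤ Real.log (1 / m) + 2 * Real.log 2 + 1) ∧
      ∀ (h : S → ℝ) (c : ℝ), 0 ≤ c → (∀ u, h u ∈ Set.Icc 0 c) → ∀ t u v,
        (A ^ t *ᵥ h) u - (A ^ t *ᵥ h) v ≤ c * τ t := by
  have hγ1 := pseudoSpectralGap_le_one hp A
  have hm1 : m ≤ 1 := by
    obtain ⟨u⟩ := ‹Nonempty S›
    rw [← hp1]
    exact (hmp u).trans
      (Finset.single_le_sum (f := p) (fun v _ => (hp v).le) (Finset.mem_univ u))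
  -- On one point the exponential rate may be below 1 at lag 0, so the indicator of lag 0 is used.
  -- With two points `m ≤ 1 / 2`, so `x₀ ≥ 1 ≥ γ` and the minimum at lag 0 is 1.
  rcases subsingleton_or_nontrivial S with hS | hS
  · refine ⟨fun k => if k = 0 then 1 else 0, by simp, fun k => by dsimp only; split_ifs <;> norm_num,
      fun k => by dsimp only; split_ifs <;> norm_num, fun N => ?_, fun h c hc hh t u v => ?_⟩
    · have h1 : ∑ k ∈ Finset.range N, (if k = 0 then (1 : ℝ) else 0) ≤ 1 := by
        rw [Finset.sum_ite_eq' (Finset.range N) 0]; split_ifs <;> norm_num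
      have h2 := one_le_log_one_div_add hm hm1
      nlinarith
    · rw [Subsingleton.elim u v, sub_self]
      refine mul_nonneg hc ?_
      dsimp only
      split_ifs <;> norm_num
  · have hm2 : m ≤ 1 / 2 := by
      obtain ⟨u, v, huv⟩ := exists_pair_ne S
      have h1 : p u + p v ≤ 1 := by
        rw [← hp1, ← Finset.sum_pair huv]
        exact Finset.sum_le_sum_of_subset_of_nonneg (Finset.subset_univ _)
          fun w _ _ => (hp w).le
      linarith [hmp u, hmp v]
    have hL : Real.log 2 ≤ Real.log (1 / m) :=
      Real.log_le_log two_pos ((le_div_iff₀ hm).2 (by linarith))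
    have hl2 := Real.log_two_gt_d9
    set x₀ := Real.log (1 / m) + 1 - Real.log 2 with hx₀
    refine ⟨fun k => min 1 (Real.exp ((x₀ - pseudoSpectralGap p A * (k + 1)) / 2)), ?_,
      fun k => le_min zero_le_one (Real.exp_pos _).le, fun k => min_le_left _ _, fun N => ?_,
      fun h c hc hh t u v => abs_pow_mulVec_sub_le hp hp1 hA0 hA hpA hγ hm hmp hc hh t u v⟩
    · refine min_eq_left (Real.one_le_exp ?_)
      push_cast
      linarith
    -- The comparison of `x₀ + 2` with the target amounts to `2 ≤ 3 log 2`.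
    · refine (mul_sum_min_exp_le (by linarith) hγ N).trans ?_
      linarith

end MixingRate

/-! ### Transition kernels as stochastic matrices -/

section TransitionMatrix

open Matrix

variable {𝒰 : Type*} [Fintype 𝒰] [MeasurableSpace 𝒰] [MeasurableSingletonClass 𝒰]

theorem transitionMatrix_mulVec_one (P : Kernel 𝒰 𝒰) [IsMarkovKernel P] :
    transitionMatrix P *ᵥ 1 = 1 := by
  ext u
  rw [← integral_transitionKernel]
  simp

theorem vecMul_transitionMatrix_of_invariant {P : Kernel 𝒰 𝒰} [IsMarkovKernel P]
    {p : Measure 𝒰} [IsProbabilityMeasure p] (h : P.Invariant p) :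
    (fun u => p.real {u}) ᵥ* transitionMatrix P = fun u => p.real {u} := by
  ext v
  have h1 : p {v} = ∫⁻ u, P u {v} ∂p := by
    conv_lhs => rw [← h.def]
    exact Measure.bind_apply (measurableSet_singleton v) P.aemeasurable
  have h2 : p.real {v} = ∫ u, (P u).real {v} ∂p := by
    rw [measureReal_def, h1, integral_eq_lintegral_of_nonneg_ae
      (Filter.Eventually.of_forall fun u => measureReal_nonneg)
      (Measurable.of_discrete).aestronglyMeasurable]
    simp
  rw [h2, integral_fintype Integrable.of_finite]
  rfl

/-- Some state has positive mass; irreducibility carries part of it to `u` in finitely many steps,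
and `p` is invariant under these. -/
theorem real_singleton_pos_of_isIrreducible [DecidableEq 𝒰] {P : Kernel 𝒰 𝒰} [IsMarkovKernel P]
    (hP : (transitionMatrix P).IsIrreducible) {p : Measure 𝒰} [IsProbabilityMeasure p]
    (h : P.Invariant p) (u : 𝒰) : 0 < p.real {u} := by
  have hsum : ∑ v, p.real {v} = 1 := by simp
  obtain ⟨w, hw⟩ : ∃ w, 0 < p.real {w} := by
    by_contra! hcon
    have : ∑ v, p.real {v} ≤ 0 := Finset.sum_nonpos fun v _ => hcon v
    linarith
  obtain ⟨k, -, hk⟩ := (isIrreducible_iff_exists_pow_pos hP.nonneg).1 hP w u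
  have h1 := congrFun (vecMul_pow (vecMul_transitionMatrix_of_invariant h) k) u
  rw [← h1]
  refine (mul_pos hw hk).trans_le ?_
  exact Finset.single_le_sum (f := fun v => p.real {v} * (transitionMatrix P ^ k) v u)
    (fun v _ => mul_nonneg measureReal_nonneg (matrix_pow_nonneg hP.nonneg k v u))
    (Finset.mem_univ w)

end TransitionMatrix

/-! ### Assembly of the PAC-Bayes bound -/

section MainTheorem

open Matrix

theorem add_futureSum_sub_le {S 𝒴 : Type*} [Fintype S] [DecidableEq S] {A : Matrix S S ℝ}
    {g : S × 𝒴 → ℝ} {h : S → ℝ} {c : ℝ} (hgc : ∀ z, g z ∈ Set.Icc 0 c) {τ : ℕ → ℝ} (hτ0 : τ 0 = 1)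
    (hτ : ∀ t u v, (A ^ t *ᵥ h) u - (A ^ t *ᵥ h) v ≤ c * τ t) (m : ℕ) (z z' : S × 𝒴) :
    (g z + futureSum A h m z.1) - (g z' + futureSum A h m z'.1)
      ≤ c * ∑ k ∈ Finset.range (m + 1), τ k := by
  rw [futureSum_eq_sum, Finset.sum_range_succ', hτ0, mul_add, mul_one]
  simp only [Finset.sum_apply]
  have h1 : ∑ k ∈ Finset.range m, (A ^ (k + 1) *ᵥ h) z.1
      - ∑ k ∈ Finset.range m, (A ^ (k + 1) *ᵥ h) z'.1 ≤ c * ∑ k ∈ Finset.range m, τ (k + 1) := by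
    rw [← Finset.sum_sub_distrib, Finset.mul_sum]
    exact Finset.sum_le_sum fun k _ => hτ _ _ _
  linarith [(hgc z).2, (hgc z').1]

variable {𝒰 𝒴 Ω : Type*} [Fintype 𝒰] [DecidableEq 𝒰] [MeasurableSpace 𝒰]
  [MeasurableSingletonClass 𝒰] [MeasurableSpace 𝒴] [MeasurableSpace Ω]
  {P : Kernel 𝒰 𝒰} [IsMarkovKernel P] {Q : Kernel 𝒰 𝒴} [IsMarkovKernel Q]
  {p : Measure 𝒰} [IsProbabilityMeasure p] {n : ℕ} {U : ℕ → Ω → 𝒰} {Y : ℕ → Ω → 𝒴}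
  {Pr : Measure Ω} [IsProbabilityMeasure Pr]

/-- Exponential moments of centred sums along a stationary Markov sample, in terms of the
pseudo-spectral gap. -/
theorem integral_exp_sub_sum_le_of_pseudoSpectralGap (hP : (transitionMatrix P).IsIrreducible)
    (hγ : 0 < pseudoSpectralGap (fun u => p.real {u}) (transitionMatrix P)) (hn : 1 ≤ n)
    (hS : IsStationarySample P Q p n U Y Pr) {g : 𝒰 × 𝒴 → ℝ} (hg : Measurable g) {c : ℝ}
    (hgc : ∀ z, g z ∈ Set.Icc 0 c) (l : ℝ) :
    ∫ ω, Real.exp (l * (∫ ω', ∑ s ∈ Finset.range n, g (U s ω', Y s ω') ∂Pr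
        - ∑ s ∈ Finset.range n, g (U s ω, Y s ω))) ∂Pr
      ≤ Real.exp (l ^ 2 * c ^ 2 / 8 * (n * ((1 - (1 / 2 : ℝ) ^ (((n : ℝ) + 1)
            * mixingConstant (⨅ u, p.real {u})
            * pseudoSpectralGap (fun u => p.real {u}) (transitionMatrix P)))
          / (1 - (1 / 2 : ℝ) ^ (mixingConstant (⨅ u, p.real {u})
            * pseudoSpectralGap (fun u => p.real {u}) (transitionMatrix P)))) ^ 2)) := by
  have hU : Nonempty 𝒰 := nonempty_of_isProbabilityMeasure p
  have hΩ : Nonempty Ω := nonempty_of_isProbabilityMeasure Pr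
  have hc : 0 ≤ c := by
    obtain ⟨ω⟩ := hΩ
    exact (hgc (U 0 ω, Y 0 ω)).1.trans (hgc (U 0 ω, Y 0 ω)).2
  have hp := real_singleton_pos_of_isIrreducible hP hS.invariant
  have hp1 : ∑ v, p.real {v} = 1 := by simp
  set m := ⨅ u, p.real {u} with hm
  have hmp : ∀ u, m ≤ p.real {u} := fun u => ciInf_le (Set.finite_range _).bddBelow u
  have hm0 : 0 < m := by
    obtain ⟨u, hu⟩ := exists_eq_ciInf_of_finite (f := fun u => p.real {u})
    rw [hm, ← hu]; exact hp u
  have hm1 : m ≤ 1 := hU.elim fun u => (hmp u).trans measureReal_le_one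
  obtain ⟨τ, hτ0, hτnn, hτ1, hτsum, hτ⟩ := exists_oscillation_rate hp hp1 hP.nonneg
    (transitionMatrix_mulVec_one P) (vecMul_transitionMatrix_of_invariant hS.invariant) hγ hm0 hmp
  have hh : ∀ u, ∫ y, g (u, y) ∂Q u ∈ Set.Icc 0 c := fun u =>
    ⟨integral_nonneg fun y => (hgc _).1, by
      have hgu : Measurable fun y => g (u, y) := hg.comp (by fun_prop)
      calc ∫ y, g (u, y) ∂Q u ≤ ∫ _, c ∂Q u :=
            integral_mono (Integrable.of_mem_Icc 0 c hgu.aemeasurable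
              (Filter.Eventually.of_forall fun y => hgc _)) (integrable_const _)
              fun y => (hgc _).2
        _ = c := by simp⟩
  refine (integral_exp_sub_sum_le hS hn hg hgc
    (add_futureSum_sub_le hgc hτ0 (hτ _ c hc hh)) l).trans (Real.exp_le_exp.2 ?_)
  have hB := one_le_log_one_div_add hm0 hm1
  have hmain := sum_sq_le_mul_sq_geom (n := n) (s := fun i => ∑ k ∈ Finset.range (i + 1), τ k)
    hγ (zero_lt_one.trans_le hB) (fun i => Finset.sum_nonneg fun k _ => hτnn k)
    (fun i => (Finset.sum_le_sum fun k _ => hτ1 k).trans (by simp)) (fun i => hτsum (i + 1))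
  simp only [mul_pow, ← Finset.mul_sum]
  calc _ = l ^ 2 * c ^ 2 / 8 * ∑ i ∈ Finset.range n, (∑ k ∈ Finset.range (i + 1), τ k) ^ 2 := by
        ring
    _ ≤ _ := mul_le_mul_of_nonneg_left hmain (by positivity)

end MainTheorem

theorem mainTheorem10
    {𝒰 𝒴 Θ Ω : Type*} [Fintype 𝒰] [DecidableEq 𝒰]
    [MeasurableSpace 𝒰] [MeasurableSingletonClass 𝒰]
    [MeasurableSpace 𝒴] [MeasurableSpace Θ] [MeasurableSpace Ω]
    (Pr : Measure Ω) [IsProbabilityMeasure Pr]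
    -- the chain: transition kernel, stationary distribution, pseudo-spectral gap
    (P : Kernel 𝒰 𝒰) [IsMarkovKernel P] (p : Measure 𝒰) [IsProbabilityMeasure p]
    (hP : (transitionMatrix P).IsIrreducible)
    (γps πmin b : ℝ)
    (hγps : γps = pseudoSpectralGap (fun u => p.real {u}) (transitionMatrix P))
    (hγps_pos : 0 < γps)
    (hπmin : πmin = ⨅ u, p.real {u})
    (hb : b = mixingConstant πmin)
    -- the sample
    (Q : Kernel 𝒰 𝒴) [IsMarkovKernel Q] (n : ℕ) (hn : 1 ≤ n)
    (U : ℕ → Ω → 𝒰) (Y : ℕ → Ω → 𝒴) (hS : IsStationarySample P Q p n U Y Pr)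
    -- the predictors and the loss
    (f : Θ → 𝒰 → 𝒴) (ℓ : 𝒴 → 𝒴 → ℝ) (c : ℝ)
    (hmeas : Measurable fun x : Θ × 𝒰 × 𝒴 => ℓ (f x.1 x.2.1) x.2.2)
    (hℓ_nonneg : ∀ y y', 0 ≤ ℓ y y') (hℓ_le : ∀ y y', ℓ y y' ≤ c)
    -- the prior and the constants
    (μ : Measure Θ) [IsProbabilityMeasure μ]
    (lam δ : ℝ) (hlam : 0 < lam) (hδ : δ ∈ Set.Ioo (0 : ℝ) 1) :
    ∃ E : Set Ω, MeasurableSet E ∧ 1 - δ ≤ Pr.real E ∧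
      ∀ ω ∈ E, ∀ ρ : Measure Θ, IsProbabilityMeasure ρ → InformationTheory.klDiv ρ μ ≠ ⊤ →
        ∫ θ, risk f ℓ n U Y Pr θ ∂ρ ≤
          ∫ θ, empiricalRisk f ℓ n U Y θ ω ∂ρ
            + lam * c ^ 2 / (8 * n)
              * ((1 - (1 / 2 : ℝ) ^ (((n : ℝ) + 1) * b * γps))
                  / (1 - (1 / 2 : ℝ) ^ (b * γps))) ^ 2
            + ((InformationTheory.klDiv ρ μ).toReal + Real.log (1 / δ)) / lam := by
  subst hγps hπmin hb
  have hΩ : Nonempty Ω := nonempty_of_isProbabilityMeasure Pr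
  have hc : 0 ≤ c := by
    obtain ⟨ω⟩ := hΩ
    exact (hℓ_nonneg (Y 0 ω) (Y 0 ω)).trans (hℓ_le _ _)
  have hn0 : (0 : ℝ) < n := by exact_mod_cast hn
  set G := (1 - (1 / 2 : ℝ) ^ (((n : ℝ) + 1) * mixingConstant (⨅ u, p.real {u})
      * pseudoSpectralGap (fun u => p.real {u}) (transitionMatrix P)))
    / (1 - (1 / 2 : ℝ) ^ (mixingConstant (⨅ u, p.real {u})
      * pseudoSpectralGap (fun u => p.real {u}) (transitionMatrix P)))
  -- a measurable modification of the sample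
  have hmod : ∀ t, ∃ Z : Ω → 𝒰 × 𝒴,
      t < n → Measurable Z ∧ (fun ω => (U t ω, Y t ω)) =ᵐ[Pr] Z := by
    intro t
    by_cases ht : t < n
    · obtain ⟨Z, hZ, hZ'⟩ := aemeasurable_sample hS ht
      exact ⟨Z, fun _ => ⟨hZ, hZ'⟩⟩
    · exact ⟨fun ω => (U t ω, Y t ω), fun h => absurd h ht⟩
  choose Z hZ using hmod
  set L : Θ → 𝒰 × 𝒴 → ℝ := fun θ z => ℓ (f θ z.1) z.2 with hL
  have hLmem : ∀ θ z, L θ z ∈ Set.Icc 0 c := fun θ z => ⟨hℓ_nonneg _ _, hℓ_le _ _⟩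
  set r : Θ × Ω → ℝ := fun x => 1 / (n : ℝ) * ∑ t ∈ Finset.range n, L x.1 (Z t x.2) with hr
  have hrm : Measurable r := by
    refine Measurable.const_mul (Finset.measurable_sum _ fun t ht => ?_) _
    have hZt := (hZ t (Finset.mem_range.1 ht)).1
    exact hmeas.comp (measurable_fst.prodMk (hZt.comp measurable_snd))
  have hrmem : ∀ x, r x ∈ Set.Icc 0 c := by
    intro x
    refine ⟨mul_nonneg (by positivity) (Finset.sum_nonneg fun t _ => (hLmem _ _).1), ?_⟩
    rw [hr, one_div, inv_mul_le_iff₀ hn0]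
    exact (Finset.sum_le_sum fun t _ => (hLmem _ _).2).trans (by simp)
  have hae : ∀ᵐ ω ∂Pr, ∀ t < n, (U t ω, Y t ω) = Z t ω := by
    refine ae_all_iff.2 fun t => ?_
    by_cases ht : t < n
    · filter_upwards [(hZ t ht).2] with ω hω _ using hω
    · exact Filter.Eventually.of_forall fun ω h => absurd h ht
  have hemp : ∀ ω, (∀ t < n, (U t ω, Y t ω) = Z t ω) →
      ∀ θ, empiricalRisk f ℓ n U Y θ ω = r (θ, ω) := by
    intro ω hω θ
    simp only [empiricalRisk, hr]
    congr 1
    exact Finset.sum_congr rfl fun t ht => by rw [← hω t (Finset.mem_range.1 ht)]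
  set R : Θ → ℝ := fun θ => ∫ ω, r (θ, ω) ∂Pr with hR
  have hrisk : ∀ θ, risk f ℓ n U Y Pr θ = R θ := fun θ =>
    integral_congr_ae (by filter_upwards [hae] with ω hω using hemp ω hω θ)
  have hRm : Measurable R := hrm.stronglyMeasurable.integral_prod_right'.measurable
  have hrθ : ∀ θ, Measurable fun ω => r (θ, ω) := fun θ => hrm.comp (by fun_prop)
  have hRmem : ∀ θ, R θ ∈ Set.Icc 0 c := fun θ =>
    ⟨integral_nonneg fun ω => (hrmem _).1, by
      calc R θ ≤ ∫ _, c ∂Pr := integral_mono (Integrable.of_mem_Icc 0 c (hrθ θ).aemeasurable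
            (Filter.Eventually.of_forall fun ω => hrmem _)) (integrable_const _)
            fun ω => (hrmem _).2
        _ = c := by simp⟩
  have hmgf : ∀ θ, ∫ ω, Real.exp (lam * (R θ - r (θ, ω))) ∂Pr
      ≤ Real.exp (lam ^ 2 * c ^ 2 / (8 * n) * G ^ 2) := by
    intro θ
    -- The risks are averages, so the parameter for sums is `lam / n`; its square times the factor
    -- `n` leaves `lam² / n`.
    have h1 := integral_exp_sub_sum_le_of_pseudoSpectralGap hP hγps_pos hn hS
      (g := L θ) (hmeas.comp (by fun_prop : Measurable fun z : 𝒰 × 𝒴 => (θ, z.1, z.2)))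
      (hLmem θ) (lam / n)
    have h2 : ∀ᵐ ω ∂Pr, r (θ, ω)
        = 1 / (n : ℝ) * ∑ t ∈ Finset.range n, L θ (U t ω, Y t ω) := by
      filter_upwards [hae] with ω hω
      exact (hemp ω hω θ).symm
    have h3 : R θ = 1 / (n : ℝ) * ∫ ω, ∑ t ∈ Finset.range n, L θ (U t ω, Y t ω) ∂Pr := by
      rw [← integral_const_mul]
      exact integral_congr_ae h2
    calc _ = _ := integral_congr_ae (by
          filter_upwards [h2] with ω hω
          rw [hω, h3, ← mul_sub, ← mul_assoc, mul_one_div])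
      _ ≤ _ := h1
      _ = _ := by
        congr 1
        change (lam / n) ^ 2 * c ^ 2 / 8 * (n * G ^ 2) = _
        clear_value G
        field_simp
  obtain ⟨E, hE, hEδ, hEρ⟩ := exists_event_forall_integral_le_klDiv (μ := μ) (Pr := Pr)
    (g := fun x : Θ × Ω => lam * (R x.1 - r x))
    (((hRm.comp measurable_fst).sub hrm).const_mul lam) (b := lam * c)
    (fun x => by
      rw [abs_mul, abs_of_pos hlam]
      refine mul_le_mul_of_nonneg_left (abs_le.2 ⟨?_, ?_⟩) hlam.le
      · linarith [(hRmem x.1).1, (hrmem x).2]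
      · linarith [(hRmem x.1).2, (hrmem x).1])
    hmgf hδ.1
  -- The modification agrees with the sample on an almost sure set independent of θ, so intersecting
  -- with it transfers the bound for all θ without changing the probability.
  obtain ⟨N, hN, hNm, hNω⟩ := hae.exists_measurable_mem
  refine ⟨E ∩ N, hE.inter hNm, ?_, ?_⟩
  · rwa [measureReal_congr (inter_ae_eq_left_of_ae_eq_univ
      (Filter.eventuallyEq_univ.2 hN))]
  · intro ω hω ρ hρ hkl
    have h1 := hEρ ω hω.1 ρ hρ hkl
    simp only [hrisk, hemp ω (hNω ω hω.2)]
    have hRint : Integrable R ρ := Integrable.of_mem_Icc 0 c hRm.aemeasurable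
      (Filter.Eventually.of_forall hRmem)
    have hrint : Integrable (fun θ => r (θ, ω)) ρ := Integrable.of_mem_Icc 0 c
      (hrm.comp (by fun_prop : Measurable fun θ : Θ => (θ, ω))).aemeasurable
      (Filter.Eventually.of_forall fun θ => hrmem _)
    rw [integral_const_mul, integral_sub hRint hrint] at h1
    have h2 : ∫ θ, R θ ∂ρ - ∫ θ, r (θ, ω) ∂ρ
        ≤ ((InformationTheory.klDiv ρ μ).toReal + lam ^ 2 * c ^ 2 / (8 * n) * G ^ 2
          + Real.log (1 / δ)) / lam := (le_div_iff₀' hlam).2 h1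
    have h3 : ((InformationTheory.klDiv ρ μ).toReal + lam ^ 2 * c ^ 2 / (8 * n) * G ^ 2
          + Real.log (1 / δ)) / lam = lam * c ^ 2 / (8 * n) * G ^ 2
          + ((InformationTheory.klDiv ρ μ).toReal + Real.log (1 / δ)) / lam := by
      field_simp
      ring
    linarith
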